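/- Let $m\ge 1$, $d\ge 2$, $n=dm$, $W=\mathbb C^m$, $V=\mathbb C^n=W^{(1)}\oplus\dots\oplus W^{(d)}$, where $\chi_k:W\to W^{(k)}$ is the natural isomorphism onto the $k$-th block of $m$ coordinates, and embed $\mathrm{GL}(m)$ in $\mathrm{GL}(n)$ diagonally by $x\mapsto\mathrm{diag}(x,\dots,x)$. Let $e_1,\dots,e_m$ be a basis of $W$; put $\hat e_{(k-1)m+r}=\chi_k(e_r)$ for $1\le k\le d$, $1\le r\le m$, which is a basis of $V$. Let $\alpha:\{1,\dots,n\}\to\{1,\dots,p\}$ be surjective, let $\mathcal F_\alpha$ be the flag of subspaces $F_{\alpha,j}=\langle \hat e_i:\alpha(i)\le j\rangle$, $1\le j\le p-1$, of $V$, and let $P\subset\mathrm{GL}(n)$ be the stabilizer of $\mathcal F_\alpha$. Put $\beta(r)=(\alpha(r),\alpha(m+r),\dots,\alpha((d-1)m+r))\in\{1,\dots,p\}^d$ for $1\le r\le m$ and assume that the image of $\beta$ is totally ordered by the componentwise order, say with elements $b_1<\dots<b_q$. Then $Q=P\cap\mathrm{GL}(m)$ is a parabolic subgroup of $\mathrm{GL}(m)$,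 namely the stabilizer of the flag $\mathcal F_\beta$ of the subspaces $F_{\beta,j}=\langle e_r:\beta(r)\le b_j\rangle$, $1\le j\le q-1$, of $W$. Let $$\phi: Y=\mathrm{GL}(m)/Q\to X=\mathrm{GL}(n)/P$$ be the morphism induced by the diagonal embedding; $X$ and $Y$ are identified with varieties of flags in $V$ and $W$ through $gP\mapsto g\mathcal F_\alpha$ and $gQ\mapsto g\mathcal F_\beta$. For $1\le j\le q-1$ let $[M_j]\in\mathrm{Pic}\,Y$ be the $j$-th preferred generator, that is, the pull-back of $\mathcal O(1)$ of the Grassmannian of $\dim F_{\beta,j}$-dimensional subspaces of $W$ (in its Plücker embedding) along the projection $gQ\mapsto gF_{\beta,j}$. Then for every $j\in\{1,\dots,q-1\}$, the image of $\phi^*:\mathrm{Pic}\,X\to\mathrm{Pic}\,Y$ is not contained in the subgroup $\langle [M_i] : i\in\{1,\dots,q-1\}\setminus\{j\}\rangle$ of $\mathrm{Pic}\,Y$. -/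

import Mathlib

open Module TopologicalSpace
set_option linter.unusedVariables false
open scoped LinearAlgebra.Projectivization

noncomputable section

namespace DiagFlag

/-! ### Complex varieties as spaces with functions -/

/-- A space with functions: a topological space with a sheaf of `ℂ`-algebras of `ℂ`-valued
functions. Complex algebraic varieties (their closed points, the Zariski topology and the regular
functions) are objects of this kind, and morphisms of varieties are the morphisms `Hom` below.
`IsRegular U f` says that the restriction of `f` to `U` is a regular function on `U`; the axiom
`glue` contains restriction to smaller open sets, independence of the values outside `U`, and
the sheaf property. -/
structure FunctionSpace where
  Pt : Type
  top : TopologicalSpace Pt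
  IsRegular : Opens Pt → (Pt → ℂ) → Prop
  const : ∀ U c, IsRegular U (fun _ => c)
  add : ∀ U f g, IsRegular U f → IsRegular U g → IsRegular U (fun x => f x + g x)
  mul : ∀ U f g, IsRegular U f → IsRegular U g → IsRegular U (fun x => f x * g x)
  glue : ∀ (U : Opens Pt) (f : Pt → ℂ),
    (∀ x ∈ U, ∃ V : Opens Pt, x ∈ V ∧ ∃ g, IsRegular V g ∧ ∀ y ∈ U, y ∈ V → f y = g y) →
    IsRegular U f

attribute [instance] FunctionSpace.top

namespace FunctionSpace

theorem IsRegular.mono {X : FunctionSpace} {U V : Opens X.Pt} {f g : X.Pt → ℂ}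
    (hf : X.IsRegular U f) (h : V ≤ U) (hg : ∀ x ∈ V, g x = f x) : X.IsRegular V g :=
  X.glue V g fun x hx => ⟨U, h hx, f, hf, fun y hy _ => hg y hy⟩

/-- `f` restricts to a unit of the ring of regular functions on `U`. -/
def IsUnitOn (X : FunctionSpace) (U : Opens X.Pt) (f : X.Pt → ℂ) : Prop :=
  (∀ x ∈ U, f x ≠ 0) ∧ X.IsRegular U f ∧ X.IsRegular U (fun x => (f x)⁻¹)

variable {X : FunctionSpace}

theorem IsUnitOn.mono {U V : Opens X.Pt} {f g : X.Pt → ℂ}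
    (hf : X.IsUnitOn U f) (h : V ≤ U) (hg : ∀ x ∈ V, g x = f x) : X.IsUnitOn V g :=
  ⟨fun x hx => by rw [hg x hx]; exact hf.1 x (h hx), hf.2.1.mono h hg,
    hf.2.2.mono h fun x hx => by rw [hg x hx]⟩

theorem isUnitOn_one (U : Opens X.Pt) : X.IsUnitOn U (fun _ => 1) :=
  ⟨fun _ _ => one_ne_zero, X.const U 1, by simpa using X.const U 1⟩

theorem IsUnitOn.mul {U : Opens X.Pt} {f g : X.Pt → ℂ}
    (hf : X.IsUnitOn U f) (hg : X.IsUnitOn U g) : X.IsUnitOn U (fun x => f x * g x) :=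
  ⟨fun x hx => mul_ne_zero (hf.1 x hx) (hg.1 x hx), X.mul U f g hf.2.1 hg.2.1,
    (X.mul U _ _ hf.2.2 hg.2.2).mono le_rfl fun x _ => mul_inv _ _⟩

theorem IsUnitOn.inv {U : Opens X.Pt} {f : X.Pt → ℂ}
    (hf : X.IsUnitOn U f) : X.IsUnitOn U (fun x => (f x)⁻¹) :=
  ⟨fun x hx => inv_ne_zero (hf.1 x hx), hf.2.2,
    hf.2.1.mono le_rfl fun x _ => inv_inv _⟩

end FunctionSpace

/-- Morphisms: continuous maps pulling regular functions back to regular functions. -/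
structure Hom (X Y : FunctionSpace) where
  toFun : X.Pt → Y.Pt
  cont : Continuous toFun
  pull : ∀ (U : Opens Y.Pt) (f : Y.Pt → ℂ), Y.IsRegular U f →
    X.IsRegular (Opens.comap ⟨toFun, cont⟩ U) (fun x => f (toFun x))

namespace Hom

variable {X Y Z : FunctionSpace}

/-- Inverse image of an open set. -/
def preim (φ : Hom X Y) (U : Opens Y.Pt) : Opens X.Pt := Opens.comap ⟨φ.toFun, φ.cont⟩ U

theorem mem_preim (φ : Hom X Y) (U : Opens Y.Pt) (x : X.Pt) :
    x ∈ φ.preim U ↔ φ.toFun x ∈ U := Iff.rfl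

theorem pullUnit (φ : Hom X Y) {U : Opens Y.Pt} {f : Y.Pt → ℂ} (hf : Y.IsUnitOn U f) :
    X.IsUnitOn (φ.preim U) (fun x => f (φ.toFun x)) :=
  ⟨fun x hx => hf.1 _ hx, φ.pull U f hf.2.1, φ.pull U _ hf.2.2⟩

/-- Composition of morphisms. -/
def comp (ψ : Hom Y Z) (φ : Hom X Y) : Hom X Z where
  toFun := fun x => ψ.toFun (φ.toFun x)
  cont := ψ.cont.comp φ.cont
  pull U f hf := φ.pull _ _ (ψ.pull U f hf)

end Hom

/-! ### The Picard group -/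

/-- A line bundle on `X` given by transition functions: an open neighbourhood `U x` of every
point `x` and invertible regular functions `g x y` on `U x ∩ U y` satisfying the cocycle
condition. (Every open cover is refined by one that is indexed by the points in this way.) -/
structure LineCocycle (X : FunctionSpace) where
  U : X.Pt → Opens X.Pt
  mem : ∀ x, x ∈ U x
  g : X.Pt → X.Pt → X.Pt → ℂ
  unit : ∀ x y, X.IsUnitOn (U x ⊓ U y) (g x y)
  cocycle : ∀ x y z w, w ∈ U x → w ∈ U y → w ∈ U z → g x y w * g y z w = g x z w

namespace LineCocycle

variable {X Y : FunctionSpace}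

/-- Isomorphism of the line bundles given by two cocycles: over a common refinement of the two
covers, the cocycles differ by a coboundary. -/
def Rel (a b : LineCocycle X) : Prop :=
  ∃ (V : X.Pt → Opens X.Pt) (h : X.Pt → X.Pt → ℂ),
    (∀ x, x ∈ V x) ∧ (∀ x, V x ≤ a.U x) ∧ (∀ x, V x ≤ b.U x) ∧
    (∀ x, X.IsUnitOn (V x) (h x)) ∧
    ∀ x y w, w ∈ V x → w ∈ V y → b.g x y w * h y w = h x w * a.g x y w

theorem Rel.of_eq {a b : LineCocycle X} (V : X.Pt → Opens X.Pt) (hV : ∀ x, x ∈ V x)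
    (ha : ∀ x, V x ≤ a.U x) (hb : ∀ x, V x ≤ b.U x)
    (h : ∀ x y w, w ∈ V x → w ∈ V y → a.g x y w = b.g x y w) : Rel a b :=
  ⟨V, fun _ _ => 1, hV, ha, hb, fun x => FunctionSpace.isUnitOn_one _, fun x y w hx hy => by
    simp [h x y w hx hy]⟩

theorem rel_equivalence : Equivalence (Rel (X := X)) where
  refl a := Rel.of_eq a.U a.mem (fun _ => le_rfl) (fun _ => le_rfl) fun _ _ _ _ _ => rfl
  symm := by
    rintro a b ⟨V, h, hV, ha, hb, hu, e⟩
    refine ⟨V, fun x w => (h x w)⁻¹, hV, hb, ha, fun x => (hu x).inv, fun x y w hx hy => ?_⟩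
    have h1 := (hu x).1 w hx
    have h2 := (hu y).1 w hy
    have h3 := e x y w hx hy
    field_simp
    linear_combination -h3
  trans := by
    rintro a b c ⟨V, h, hV, ha, hb, hu, e⟩ ⟨V', h', hV', hb', hc', hu', e'⟩
    refine ⟨fun x => V x ⊓ V' x, fun x w => h x w * h' x w, fun x => ⟨hV x, hV' x⟩,
      fun x => inf_le_left.trans (ha x), fun x => inf_le_right.trans (hc' x),
      fun x => ((hu x).mono inf_le_left fun _ _ => rfl).mul
        ((hu' x).mono inf_le_right fun _ _ => rfl), fun x y w hx hy => ?_⟩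
    have h1 := e x y w hx.1 hy.1
    have h2 := e' x y w hx.2 hy.2
    linear_combination h y w * h2 + h' x w * h1

instance setoid (X : FunctionSpace) : Setoid (LineCocycle X) := ⟨Rel, rel_equivalence⟩

/-- The trivial line bundle. -/
def one (X : FunctionSpace) : LineCocycle X where
  U _ := ⊤
  mem _ := trivial
  g _ _ _ := 1
  unit _ _ := FunctionSpace.isUnitOn_one _
  cocycle _ _ _ _ _ _ _ := by simp

/-- The tensor product of line bundles. -/
def tensor (a b : LineCocycle X) : LineCocycle X where
  U x := a.U x ⊓ b.U x
  mem x := ⟨a.mem x, b.mem x⟩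
  g x y w := a.g x y w * b.g x y w
  unit x y := ((a.unit x y).mono (inf_le_inf inf_le_left inf_le_left) fun _ _ => rfl).mul
    ((b.unit x y).mono (inf_le_inf inf_le_right inf_le_right) fun _ _ => rfl)
  cocycle x y z w hx hy hz := by
    have h1 := a.cocycle x y z w hx.1 hy.1 hz.1
    have h2 := b.cocycle x y z w hx.2 hy.2 hz.2
    rw [← h1, ← h2]; ring

/-- The dual line bundle. -/
def dual (a : LineCocycle X) : LineCocycle X where
  U := a.U
  mem := a.mem
  g x y w := (a.g x y w)⁻¹
  unit x y := (a.unit x y).inv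
  cocycle x y z w hx hy hz := by rw [← a.cocycle x y z w hx hy hz, mul_inv]

/-- The pull-back of a line bundle along a morphism. -/
def pullback (φ : Hom X Y) (a : LineCocycle Y) : LineCocycle X where
  U x := φ.preim (a.U (φ.toFun x))
  mem x := a.mem (φ.toFun x)
  g x y w := a.g (φ.toFun x) (φ.toFun y) (φ.toFun w)
  unit x y := φ.pullUnit (a.unit (φ.toFun x) (φ.toFun y))
  cocycle x y z w hx hy hz := a.cocycle _ _ _ _ hx hy hz

theorem tensor_rel {a a' b b' : LineCocycle X} (h : Rel a a') (k : Rel b b') :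
    Rel (tensor a b) (tensor a' b') := by
  obtain ⟨V, h, hV, ha, hb, hu, e⟩ := h
  obtain ⟨V', h', hV', ha', hb', hu', e'⟩ := k
  refine ⟨fun x => V x ⊓ V' x, fun x w => h x w * h' x w, fun x => ⟨hV x, hV' x⟩,
    fun x => inf_le_inf (ha x) (ha' x), fun x => inf_le_inf (hb x) (hb' x),
    fun x => ((hu x).mono inf_le_left fun _ _ => rfl).mul
      ((hu' x).mono inf_le_right fun _ _ => rfl), fun x y w hx hy => ?_⟩
  have h1 := e x y w hx.1 hy.1
  have h2 := e' x y w hx.2 hy.2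
  simp only [tensor]
  linear_combination (b'.g x y w * h' y w) * h1 + (h x w * a.g x y w) * h2

theorem dual_rel {a b : LineCocycle X} (h : Rel a b) : Rel (dual a) (dual b) := by
  obtain ⟨V, h, hV, ha, hb, hu, e⟩ := h
  refine ⟨V, fun x w => (h x w)⁻¹, hV, ha, hb, fun x => (hu x).inv, fun x y w hx hy => ?_⟩
  simp only [dual]
  rw [← mul_inv, e x y w hx hy, mul_inv]

theorem pullback_rel (φ : Hom X Y) {a b : LineCocycle Y} (h : Rel a b) :
    Rel (pullback φ a) (pullback φ b) := by
  obtain ⟨V, h, hV, ha, hb, hu, e⟩ := h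
  exact ⟨fun x => φ.preim (V (φ.toFun x)), fun x w => h (φ.toFun x) (φ.toFun w),
    fun x => hV _, fun x _ hw => ha _ hw, fun x _ hw => hb _ hw,
    fun x => φ.pullUnit (hu _), fun x y w hx hy => e _ _ _ hx hy⟩

end LineCocycle

/-- The Picard group: isomorphism classes of line bundles, written additively. -/
def Pic (X : FunctionSpace) : Type := Quotient (LineCocycle.setoid X)

namespace Pic

variable {X Y : FunctionSpace}

/-- The class of a line bundle. -/
def mk (a : LineCocycle X) : Pic X := Quotient.mk _ a

instance : Zero (Pic X) := ⟨mk (LineCocycle.one X)⟩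

instance : Add (Pic X) :=
  ⟨Quotient.map₂ LineCocycle.tensor fun _ _ h _ _ k => LineCocycle.tensor_rel h k⟩

instance : Neg (Pic X) := ⟨Quotient.map LineCocycle.dual fun _ _ h => LineCocycle.dual_rel h⟩

theorem mk_eq {a b : LineCocycle X} (h : LineCocycle.Rel a b) : mk a = mk b := Quotient.sound h

instance : AddCommGroup (Pic X) where
  add_assoc a b c := Quotient.inductionOn₃ a b c fun a b c =>
    mk_eq <| LineCocycle.Rel.of_eq (fun x => a.U x ⊓ b.U x ⊓ c.U x)
      (fun x => ⟨⟨a.mem x, b.mem x⟩, c.mem x⟩) (fun _ => le_rfl)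
      (fun _ => (inf_assoc _ _ _).le) fun _ _ _ _ _ => mul_assoc _ _ _
  zero_add a := Quotient.inductionOn a fun a =>
    mk_eq <| LineCocycle.Rel.of_eq a.U a.mem (fun _ => le_inf le_top le_rfl) (fun _ => le_rfl)
      fun _ _ _ _ _ => one_mul _
  add_zero a := Quotient.inductionOn a fun a =>
    mk_eq <| LineCocycle.Rel.of_eq a.U a.mem (fun _ => le_inf le_rfl le_top) (fun _ => le_rfl)
      fun _ _ _ _ _ => mul_one _
  nsmul := nsmulRec
  zsmul := zsmulRec
  neg_add_cancel a := Quotient.inductionOn a fun a =>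
    mk_eq <| LineCocycle.Rel.of_eq a.U a.mem (fun _ => le_inf le_rfl le_rfl) (fun _ => le_top)
      fun x y w hx hy => inv_mul_cancel₀ ((a.unit x y).1 w ⟨hx, hy⟩)
  add_comm a b := Quotient.inductionOn₂ a b fun a b =>
    mk_eq <| LineCocycle.Rel.of_eq (fun x => a.U x ⊓ b.U x) (fun x => ⟨a.mem x, b.mem x⟩)
      (fun _ => le_rfl) (fun _ => (inf_comm _ _).le) fun _ _ _ _ _ => mul_comm _ _

/-- The pull-back homomorphism `φ^* : Pic Y → Pic X` of a morphism `φ : X → Y`. -/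
def map (φ : Hom X Y) : Pic Y →+ Pic X where
  toFun := Quotient.map (LineCocycle.pullback φ) fun _ _ h => LineCocycle.pullback_rel φ h
  map_zero' := mk_eq <| LineCocycle.Rel.of_eq (fun _ => ⊤) (fun _ => trivial)
    (fun _ _ _ => trivial) (fun _ => le_rfl) fun _ _ _ _ _ => rfl
  map_add' a b := Quotient.inductionOn₂ a b fun a b =>
    mk_eq <| LineCocycle.Rel.of_eq
      (fun x => φ.preim (a.U (φ.toFun x)) ⊓ φ.preim (b.U (φ.toFun x)))
      (fun _ => ⟨a.mem _, b.mem _⟩) (fun _ _ h => h) (fun _ _ h => h) fun _ _ _ _ _ => rfl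

end Pic

/-! ### Affine spaces, subspaces, quotients -/

/-- The polynomial functions on a complex vector space: the algebra of functions generated by
the linear functionals. -/
def polyFun (E : Type) [AddCommGroup E] [Module ℂ E] : Subalgebra ℂ (E → ℂ) :=
  Algebra.adjoin ℂ (Set.range fun (l : Dual ℂ E) (v : E) => l v)

/-- The Zariski topology of a vector space: the principal open sets `{c ≠ 0}` form a basis. -/
@[reducible]
def zariski (E : Type) [AddCommGroup E] [Module ℂ E] : TopologicalSpace E where
  IsOpen U := ∀ x ∈ U, ∃ c ∈ polyFun E, c x ≠ 0 ∧ ∀ y, c y ≠ 0 → y ∈ U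
  isOpen_univ _ _ := ⟨1, one_mem _, one_ne_zero, fun _ _ => trivial⟩
  isOpen_inter U V hU hV x hx := by
    obtain ⟨c, hc, h1, h2⟩ := hU x hx.1
    obtain ⟨c', hc', h1', h2'⟩ := hV x hx.2
    exact ⟨c * c', mul_mem hc hc', mul_ne_zero h1 h1',
      fun y hy => ⟨h2 y (left_ne_zero_of_mul hy), h2' y (right_ne_zero_of_mul hy)⟩⟩
  isOpen_sUnion S hS x := by
    rintro ⟨U, hU, hx⟩
    obtain ⟨c, hc, h1, h2⟩ := hS U hU x hx
    exact ⟨c, hc, h1, fun y hy => ⟨U, hU, h2 y hy⟩⟩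

/-- The affine space of a vector space `E`. A function is regular on `U` if around every point of
`U` it is a quotient `a / b` of polynomial functions. -/
def affineSpace (E : Type) [AddCommGroup E] [Module ℂ E] : FunctionSpace where
  Pt := E
  top := zariski E
  IsRegular U f := ∀ x ∈ U, ∃ a ∈ polyFun E, ∃ b ∈ polyFun E, b x ≠ 0 ∧
    ∀ y ∈ U, b y ≠ 0 → f y = a y / b y
  const U c x _ := ⟨fun _ => c, (polyFun E).algebraMap_mem c, 1, one_mem _, one_ne_zero,
    fun y _ _ => by simp⟩
  add U f g hf hg x hx := by
    obtain ⟨a, ha, b, hb, h1, h2⟩ := hf x hx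
    obtain ⟨a', ha', b', hb', h1', h2'⟩ := hg x hx
    refine ⟨a * b' + b * a', add_mem (mul_mem ha hb') (mul_mem hb ha'), b * b', mul_mem hb hb',
      mul_ne_zero h1 h1', fun y hy hby => ?_⟩
    have k := left_ne_zero_of_mul hby
    have k' := right_ne_zero_of_mul hby
    change f y + g y = (a y * b' y + b y * a' y) / (b y * b' y)
    rw [h2 y hy k, h2' y hy k', div_add_div _ _ k k']
  mul U f g hf hg x hx := by
    obtain ⟨a, ha, b, hb, h1, h2⟩ := hf x hx
    obtain ⟨a', ha', b', hb', h1', h2'⟩ := hg x hx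
    refine ⟨a * a', mul_mem ha ha', b * b', mul_mem hb hb',
      mul_ne_zero h1 h1', fun y hy hby => ?_⟩
    change f y * g y = (a y * a' y) / (b y * b' y)
    rw [h2 y hy (left_ne_zero_of_mul hby), h2' y hy (right_ne_zero_of_mul hby), div_mul_div_comm]
  glue U f h x hx := by
    let _ : TopologicalSpace E := zariski E
    obtain ⟨V, hxV, g, hg, hfg⟩ := h x hx
    obtain ⟨a, ha, b, hb, h1, h2⟩ := hg x hxV
    obtain ⟨c, hc, h3, h4⟩ := V.2 x hxV
    refine ⟨a * c, mul_mem ha hc, b * c, mul_mem hb hc, mul_ne_zero h1 h3, fun y hy hbc => ?_⟩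
    have k := right_ne_zero_of_mul hbc
    rw [hfg y hy (h4 y k), h2 y (h4 y k) (left_ne_zero_of_mul hbc)]
    exact (mul_div_mul_right _ _ k).symm

/-- The structure of a subspace: the one induced on `T` by an injection `c` of `T` onto a (locally
closed) subset of `Y`. Regular functions are those that are locally restrictions of regular
functions of `Y`. -/
def subspace (Y : FunctionSpace) {T : Type} (c : T → Y.Pt) : FunctionSpace where
  Pt := T
  top := TopologicalSpace.induced c Y.top
  IsRegular U f := ∀ x ∈ U, ∃ V : Opens Y.Pt, c x ∈ V ∧ ∃ g, Y.IsRegular V g ∧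
    ∀ y ∈ U, c y ∈ V → f y = g (c y)
  const U k x _ := ⟨⊤, trivial, fun _ => k, Y.const _ _, fun _ _ _ => rfl⟩
  add U f g hf hg x hx := by
    obtain ⟨V, hV, a, ha, h⟩ := hf x hx
    obtain ⟨V', hV', a', ha', h'⟩ := hg x hx
    refine ⟨V ⊓ V', ⟨hV, hV'⟩, fun y => a y + a' y, Y.add _ _ _ (ha.mono inf_le_left fun _ _ => rfl)
      (ha'.mono inf_le_right fun _ _ => rfl), fun y hy hyV => ?_⟩
    exact congrArg₂ _ (h y hy hyV.1) (h' y hy hyV.2)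
  mul U f g hf hg x hx := by
    obtain ⟨V, hV, a, ha, h⟩ := hf x hx
    obtain ⟨V', hV', a', ha', h'⟩ := hg x hx
    refine ⟨V ⊓ V', ⟨hV, hV'⟩, fun y => a y * a' y, Y.mul _ _ _ (ha.mono inf_le_left fun _ _ => rfl)
      (ha'.mono inf_le_right fun _ _ => rfl), fun y hy hyV => ?_⟩
    exact congrArg₂ _ (h y hy hyV.1) (h' y hy hyV.2)
  glue U f h x hx := by
    let _ : TopologicalSpace T := TopologicalSpace.induced c Y.top
    obtain ⟨V, hxV, g, hg, hfg⟩ := h x hx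
    obtain ⟨W, hW, k, hk, hgk⟩ := hg x hxV
    obtain ⟨V', hV', hVV'⟩ := V.2
    have hmem : ∀ y, y ∈ V ↔ c y ∈ V' := fun y => by
      change y ∈ (V : Set T) ↔ _
      exact (Set.ext_iff.mp hVV' y).symm
    refine ⟨W ⊓ ⟨V', hV'⟩, ⟨hW, (hmem x).1 hxV⟩, k, hk.mono inf_le_left fun _ _ => rfl,
      fun y hy hyW => ?_⟩
    have hyV := (hmem y).2 hyW.2
    rw [hfg y hy hyV, hgk y hyV hyW.1]

/-- The structure of a quotient: the finest one on `T` for which the (surjective) map `π` is a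
morphism. -/
def quotientSpace (X : FunctionSpace) {T : Type} (π : X.Pt → T) : FunctionSpace where
  Pt := T
  top := TopologicalSpace.coinduced π X.top
  IsRegular U f :=
    let _ : TopologicalSpace T := TopologicalSpace.coinduced π X.top
    X.IsRegular ⟨π ⁻¹' U, U.2⟩ (fun x => f (π x))
  const U c := X.const _ c
  add U f g hf hg := X.add _ _ _ hf hg
  mul U f g hf hg := X.mul _ _ _ hf hg
  glue U f h := X.glue _ _ fun x hx => by
    let _ : TopologicalSpace T := TopologicalSpace.coinduced π X.top
    obtain ⟨V, hV, g, hg, hfg⟩ := h (π x) hx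
    exact ⟨⟨π ⁻¹' V, V.2⟩, hV, fun y => g (π y), hg, fun y hy hyV => hfg (π y) hy hyV⟩

namespace Hom

variable {X Y Z : FunctionSpace}

/-- The inclusion of a subspace. -/
def incl (Y : FunctionSpace) {T : Type} (c : T → Y.Pt) : Hom (subspace Y c) Y where
  toFun := c
  cont := continuous_induced_dom
  pull U f hf _ hx := ⟨U, hx, f, hf, fun _ _ _ => rfl⟩

/-- A map into a subspace is a morphism if it is one into the ambient space. -/
def toSubspace {T : Type} (c : T → Y.Pt) (φ : Hom X Y) (f : X.Pt → T)
    (h : ∀ x, φ.toFun x = c (f x)) : Hom X (subspace Y c) where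
  toFun := f
  cont := by
    refine continuous_induced_rng.2 ?_
    have : φ.toFun = c ∘ f := funext h
    exact this ▸ φ.cont
  pull U k hk := X.glue _ _ fun x hx => by
    obtain ⟨V, hV, g, hg, hkg⟩ := hk (f x) hx
    refine ⟨φ.preim V, ?_, fun y => g (φ.toFun y), φ.pull V g hg, fun y hy hyV => ?_⟩
    · rw [mem_preim, h]; exact hV
    · rw [mem_preim, h] at hyV
      exact (hkg (f y) hy hyV).trans (congrArg g (h y).symm)

/-- The projection to a quotient. -/
def proj (X : FunctionSpace) {T : Type} (π : X.Pt → T) : Hom X (quotientSpace X π) where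
  toFun := π
  cont := continuous_coinduced_rng
  pull _ _ hf := hf

/-- A map from a quotient is a morphism if its composition with the projection is one. -/
def fromQuotient {T : Type} (π : X.Pt → T) (φ : Hom X Z) (f : T → Z.Pt)
    (h : ∀ x, f (π x) = φ.toFun x) : Hom (quotientSpace X π) Z where
  toFun := f
  cont := by
    refine continuous_coinduced_dom.2 ?_
    have : f ∘ π = φ.toFun := funext h
    exact this ▸ φ.cont
  pull U k hk := by
    refine (φ.pull U k hk).mono (fun x hx => ?_) fun x _ => ?_
    · change φ.toFun x ∈ U
      rw [← h]; exact hx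
    · exact congrArg k (h x)

theorem poly_comp {E E' : Type} [AddCommGroup E] [Module ℂ E] [AddCommGroup E'] [Module ℂ E']
    (f : E → E') (hf : ∀ l : Dual ℂ E', (fun v => l (f v)) ∈ polyFun E)
    (c : E' → ℂ) (hc : c ∈ polyFun E') : (fun v => c (f v)) ∈ polyFun E := by
  induction hc using Algebra.adjoin_induction with
  | mem x hx => obtain ⟨l, rfl⟩ := hx; exact hf l
  | algebraMap r => exact (polyFun E).algebraMap_mem r
  | add x y _ _ hx hy => exact add_mem hx hy
  | mul x y _ _ hx hy => exact mul_mem hx hy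

/-- Polynomial maps are morphisms of affine spaces. -/
def ofPoly {E E' : Type} [AddCommGroup E] [Module ℂ E] [AddCommGroup E'] [Module ℂ E']
    (f : E → E') (hf : ∀ l : Dual ℂ E', (fun v => l (f v)) ∈ polyFun E) :
    Hom (affineSpace E) (affineSpace E') where
  toFun := f
  cont := by
    refine continuous_def.2 fun U hU x hx => ?_
    obtain ⟨c, hc, h1, h2⟩ := hU (f x) hx
    exact ⟨fun v => c (f v), poly_comp f hf c hc, h1, fun y hy => h2 _ hy⟩
  pull U k hk x hx := by
    obtain ⟨a, ha, b, hb, h1, h2⟩ := hk (f x) hx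
    exact ⟨_, poly_comp f hf a ha, _, poly_comp f hf b hb, h1, fun y hy => h2 (f y) hy⟩

end Hom

/-! ### Projective spaces and the line bundle `O(1)` -/

section Projective

variable (E : Type) [AddCommGroup E] [Module ℂ E]

/-- `E ∖ {0}` as an open subvariety of the affine space `E`. -/
def puncturedSpace : FunctionSpace :=
  subspace (affineSpace E) (T := {v : E // v ≠ 0}) fun v => v.1

/-- The projective space of lines in `E`, as the quotient of `E ∖ {0}`. -/
def projectiveSpace : FunctionSpace :=
  quotientSpace (puncturedSpace E) (T := ℙ ℂ E) fun v => Projectivization.mk' ℂ v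

/-- The projection `E ∖ {0} → ℙ(E)`. -/
def toProjective : Hom (puncturedSpace E) (projectiveSpace E) :=
  Hom.proj (puncturedSpace E) (T := ℙ ℂ E) fun v => Projectivization.mk' ℂ v

variable {E}

theorem exists_functional (x : ℙ ℂ E) : ∃ l : Dual ℂ E, l x.rep ≠ 0 := by
  by_contra! h
  exact x.rep_nonzero ((Module.forall_dual_apply_eq_zero_iff ℂ x.rep).1 h)

/-- A linear form that does not vanish at the point `x`. -/
def functional (x : ℙ ℂ E) : Dual ℂ E := (exists_functional x).choose

theorem apply_rep_ne_zero_iff (l : Dual ℂ E) (v : {v : E // v ≠ 0}) :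
    l (Projectivization.mk' ℂ v).rep ≠ 0 ↔ l v.1 ≠ 0 := by
  rw [Projectivization.mk'_eq_mk]
  obtain ⟨a, ha⟩ := Projectivization.exists_smul_eq_mk_rep ℂ v.1 v.2
  rw [← ha, Units.smul_def, map_smul]
  simp

theorem apply_div_apply_rep (l l' : Dual ℂ E) (v : {v : E // v ≠ 0}) :
    l (Projectivization.mk' ℂ v).rep / l' (Projectivization.mk' ℂ v).rep = l v.1 / l' v.1 := by
  rw [Projectivization.mk'_eq_mk]
  obtain ⟨a, ha⟩ := Projectivization.exists_smul_eq_mk_rep ℂ v.1 v.2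
  rw [← ha, Units.smul_def, map_smul, map_smul, smul_eq_mul, smul_eq_mul,
    mul_div_mul_left _ _ a.ne_zero]

theorem linear_mem_polyFun (l : Dual ℂ E) : (fun v => l v) ∈ polyFun E :=
  Algebra.subset_adjoin ⟨l, rfl⟩

/-- The open set of the points of the projective space where the linear form `l` does not
vanish. -/
def basicOpen (l : Dual ℂ E) : Opens (projectiveSpace E).Pt where
  carrier := {x : ℙ ℂ E | l x.rep ≠ 0}
  is_open' := by
    change @IsOpen _ (TopologicalSpace.induced (fun v : {v : E // v ≠ 0} => v.1) (zariski E)) _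
    refine ⟨{v : E | l v ≠ 0}, fun v hv => ⟨_, linear_mem_polyFun l, hv, fun _ h => h⟩, ?_⟩
    ext v
    exact (apply_rep_ne_zero_iff l v).symm

theorem regular_quotient (l l' : Dual ℂ E) (U : Opens (projectiveSpace E).Pt)
    (hU : U ≤ basicOpen l') :
    (projectiveSpace E).IsRegular U fun x : ℙ ℂ E => l x.rep / l' x.rep := by
  intro v hv
  have hne : ∀ w : {v : E // v ≠ 0}, Projectivization.mk' ℂ w ∈ U → l' w.1 ≠ 0 :=
    fun w hw => (apply_rep_ne_zero_iff l' w).1 (hU hw)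
  refine ⟨⟨{w : E | l' w ≠ 0}, fun w hw => ⟨_, linear_mem_polyFun l', hw, fun _ h => h⟩⟩,
    hne v hv, fun w : E => l w / l' w, fun w hw =>
    ⟨_, linear_mem_polyFun l, _, linear_mem_polyFun l', hw, fun _ _ _ => rfl⟩,
    fun w _ _ => apply_div_apply_rep l l' w⟩

/-- The line bundle `O(1)` on a projective space, whose sections are the linear forms: over
`{l ≠ 0}` a linear form `s` is the function `s / l`, so the transition functions are the
quotients of linear forms. -/
def hyperplaneBundle (E : Type) [AddCommGroup E] [Module ℂ E] :
    LineCocycle (projectiveSpace E) where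
  U x := basicOpen (functional x)
  mem x := (exists_functional (E := E) x).choose_spec
  g x y := fun w : ℙ ℂ E => functional y w.rep / functional x w.rep
  unit x y := by
    refine ⟨fun w hw => div_ne_zero hw.2 hw.1, regular_quotient _ _ _ inf_le_left, ?_⟩
    simp only [inv_div]
    exact regular_quotient _ _ _ inf_le_right
  cocycle x y z w hx hy hz := by
    have hx' : functional x (Projectivization.rep w) ≠ 0 := hx
    have hy' : functional y (Projectivization.rep w) ≠ 0 := hy
    field_simp

end Projective

/-! ### Grassmannians -/

/-- The set of `p`-dimensional subspaces of `ℂ^n`. -/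
abbrev Subsp (n p : ℕ) : Type := {S : Submodule ℂ (Fin n → ℂ) // finrank ℂ S = p}

theorem finrank_range_map {n p : ℕ} (S : Subsp n p) :
    finrank ℂ (LinearMap.range (exteriorPower.map p S.1.subtype)) = 1 := by
  rw [LinearMap.finrank_range_of_inj (exteriorPower.map_injective_field (by simp)),
    exteriorPower.finrank_eq, S.2, Nat.choose_self]

/-- The Plücker map: `S` is sent to the line `⋀^p S` in `⋀^p ℂ^n`. -/
def plucker {n p : ℕ} (S : Subsp n p) : ℙ ℂ (⋀[ℂ]^p (Fin n → ℂ)) :=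
  Projectivization.mk'' (LinearMap.range (exteriorPower.map p S.1.subtype)) (finrank_range_map S)

/-- The Grassmannian, as a subvariety of a projective space through the Plücker embedding. -/
def grassmannian (n p : ℕ) : FunctionSpace :=
  subspace (projectiveSpace (⋀[ℂ]^p (Fin n → ℂ))) (T := Subsp n p) plucker

/-- The class of `O(1)` on the Grassmannian: the pull-back of `O(1)` along the Plücker
embedding. -/
def grassmannianO1 (n p : ℕ) : Pic (grassmannian n p) :=
  Pic.map (Hom.incl _ _) (Pic.mk (hyperplaneBundle (⋀[ℂ]^p (Fin n → ℂ))))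

/-! ### The homogeneous spaces of `GL(n)` -/

/-- The group `GL(n)`. -/
abbrev G (n : ℕ) : Type := Matrix.GeneralLinearGroup (Fin n) ℂ

/-- `GL(n)` as an open subvariety of the affine space of matrices. -/
def glVariety (n : ℕ) : FunctionSpace :=
  subspace (affineSpace (Matrix (Fin n) (Fin n) ℂ)) (T := G n) fun g => g.1

/-- The homogeneous space `GL(n) / H`, as the quotient of `GL(n)` by `H`. -/
def homogeneousSpace (n : ℕ) (H : Subgroup (G n)) : FunctionSpace :=
  quotientSpace (glVariety n) (T := G n ⧸ H) fun g => QuotientGroup.mk g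

/-- The image `g S` of a subspace under `g ∈ GL(n)`. -/
def act {n : ℕ} (g : G n) (S : Submodule ℂ (Fin n → ℂ)) : Submodule ℂ (Fin n → ℂ) :=
  S.map (Matrix.mulVecLin g.1)

theorem mem_act {n : ℕ} {g : G n} {S : Submodule ℂ (Fin n → ℂ)} {v : Fin n → ℂ} :
    v ∈ act g S ↔ ∃ w ∈ S, g.1.mulVec w = v := Iff.rfl

theorem act_one {n : ℕ} (S : Submodule ℂ (Fin n → ℂ)) : act 1 S = S := by
  simp [act]

theorem act_mul {n : ℕ} (g h : G n) (S : Submodule ℂ (Fin n → ℂ)) :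
    act (g * h) S = act g (act h S) := by
  simp [act, Matrix.mulVecLin_mul, Submodule.map_comp]

theorem mulVec_injective {n : ℕ} (g : G n) : Function.Injective g.1.mulVecLin := by
  refine Function.LeftInverse.injective (g := (g⁻¹ : G n).1.mulVecLin) fun v => ?_
  simp only [Matrix.mulVecLin_apply, Matrix.mulVec_mulVec, ← Units.val_mul, inv_mul_cancel]
  simp

theorem finrank_act {n : ℕ} (g : G n) (S : Submodule ℂ (Fin n → ℂ)) :
    finrank ℂ (act g S) = finrank ℂ S :=
  (S.equivMapOfInjective _ (mulVec_injective g)).finrank_eq.symm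

/-- The stabilizer in `GL(n)` of a flag, that is, of a family of subspaces. -/
def stab {n k : ℕ} (F : Fin k → Submodule ℂ (Fin n → ℂ)) : Subgroup (G n) where
  carrier := {g | ∀ j, act g (F j) = F j}
  one_mem' j := act_one _
  mul_mem' {g h} hg hh j := by rw [act_mul, hh j, hg j]
  inv_mem' {g} hg j := by
    conv_lhs => rw [← hg j]
    rw [← act_mul, inv_mul_cancel, act_one]

theorem mem_stab_iff {n k : ℕ} {F : Fin k → Submodule ℂ (Fin n → ℂ)} {g : G n} :
    g ∈ stab F ↔ ∀ j, ∀ v ∈ F j, g.1.mulVec v ∈ F j := by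
  constructor
  · intro h j v hv
    rw [← h j]
    exact ⟨v, hv, rfl⟩
  · intro h j
    refine Submodule.eq_of_le_of_finrank_eq ?_ (finrank_act g (F j))
    rintro _ ⟨v, hv, rfl⟩
    exact h j v hv

theorem multilinear_mem_polyFun {n p : ℕ} (M : MultilinearMap ℂ (fun _ : Fin p => Fin n → ℂ) ℂ)
    (v : Fin p → Fin n → ℂ) :
    (fun A : Matrix (Fin n) (Fin n) ℂ => M fun i => A.mulVec (v i)) ∈
      polyFun (Matrix (Fin n) (Fin n) ℂ) := by
  have h : (fun A : Matrix (Fin n) (Fin n) ℂ => M fun i => A.mulVec (v i)) =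
      ∑ r : Fin p → Fin n, (∏ i, fun A : Matrix (Fin n) (Fin n) ℂ => A.mulVec (v i) (r i)) *
        fun _ => M fun i => Pi.single (r i) 1 := by
    funext A
    have h1 : (fun i => A.mulVec (v i)) =
        fun i => ∑ j, A.mulVec (v i) j • (Pi.single j 1 : Fin n → ℂ) := by
      funext i
      exact pi_eq_sum_univ' _
    conv_lhs => rw [h1]
    rw [MultilinearMap.map_sum, Finset.sum_apply]
    refine Finset.sum_congr rfl fun r _ => ?_
    rw [MultilinearMap.map_smul_univ, Pi.mul_apply, Finset.prod_apply, smul_eq_mul]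
  rw [h]
  refine sum_mem fun r _ => mul_mem (prod_mem fun i _ => ?_) ((polyFun _).algebraMap_mem _)
  exact linear_mem_polyFun
    ((LinearMap.proj (r i)).comp ((Matrix.mulVecBilin ℂ ℂ).flip (v i)))

section Orbit

variable {n p : ℕ}

/-- A basis of a `p`-dimensional subspace. -/
def frame (S : Subsp n p) : Basis (Fin p) ℂ S.1 := finBasisOfFinrankEq ℂ S.1 S.2

theorem frame_indep (S : Subsp n p) (g : G n) :
    LinearIndependent ℂ fun i => g.1.mulVec (frame S i).1 :=
  ((frame S).linearIndependent.map' S.1.subtype (by simp)).map' g.1.mulVecLin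
    (LinearMap.ker_eq_bot.2 (mulVec_injective g))

/-- The subspace `g S`. -/
def translate (g : G n) (S : Subsp n p) : Subsp n p := ⟨act g S.1, (finrank_act g S.1).trans S.2⟩

theorem wedge_ne_zero {w : Fin p → Fin n → ℂ} (h : LinearIndependent ℂ w) :
    exteriorPower.ιMulti ℂ p w ≠ 0 := by
  have := (exteriorPower.ιMulti_family_linearIndependent_field p h).ne_zero
    (Set.powersetCard.ofFinEmbEquiv (RelEmbedding.refl (α := Fin p) (· ≤ ·)))
  rw [exteriorPower.ιMulti_family, Equiv.symm_apply_apply] at this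
  exact this

theorem plucker_translate (g : G n) (S : Subsp n p) :
    plucker (translate g S) =
      Projectivization.mk' ℂ ⟨exteriorPower.ιMulti ℂ p fun i => g.1.mulVec (frame S i).1,
        wedge_ne_zero (frame_indep S g)⟩ := by
  apply Projectivization.submodule_injective
  rw [plucker, Projectivization.submodule_mk'', Projectivization.mk'_eq_mk,
    Projectivization.submodule_mk]
  refine (Submodule.eq_of_le_of_finrank_eq ?_ ?_).symm
  · rw [Submodule.span_singleton_le_iff_mem]
    refine ⟨exteriorPower.ιMulti ℂ p fun i =>
      (⟨g.1.mulVec (frame S i).1, (frame S i).1, (frame S i).2, rfl⟩ : act g S.1), ?_⟩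
    exact exteriorPower.map_apply_ιMulti (act g S.1).subtype _
  · rw [finrank_range_map, finrank_span_singleton (wedge_ne_zero (frame_indep S g))]

/-- The morphism `GL(n) → ⋀^p ℂ^n ∖ {0}`, `g ↦ g v_1 ∧ … ∧ g v_p`, for a basis `v` of `S`. -/
def wedgeMorphism (S : Subsp n p) : Hom (glVariety n) (puncturedSpace (⋀[ℂ]^p (Fin n → ℂ))) :=
  Hom.toSubspace _
    ((Hom.ofPoly (fun A : Matrix (Fin n) (Fin n) ℂ =>
        exteriorPower.ιMulti ℂ p fun i => A.mulVec (frame S i).1)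
      fun l => multilinear_mem_polyFun
        (l.compMultilinearMap (exteriorPower.ιMulti ℂ p).toMultilinearMap) _).comp
      (Hom.incl _ _))
    (fun g : G n => ⟨exteriorPower.ιMulti ℂ p fun i => g.1.mulVec (frame S i).1,
      wedge_ne_zero (frame_indep S g)⟩)
    fun _ => rfl

/-- The morphism `GL(n) → Gr(p; ℂ^n)`, `g ↦ g S`. -/
def orbitMorphism (S : Subsp n p) : Hom (glVariety n) (grassmannian n p) :=
  Hom.toSubspace (Y := projectiveSpace (⋀[ℂ]^p (Fin n → ℂ))) plucker
    ((toProjective _).comp (wedgeMorphism S))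
    (fun g : G n => translate g S) fun g => (plucker_translate g S).symm

/-- The morphism `GL(n)/H → Gr(p; ℂ^n)`, `g H ↦ g S`, where `H` stabilizes `S`. -/
def cosetMorphism (H : Subgroup (G n)) (S : Subsp n p) (h : ∀ g ∈ H, act g S.1 = S.1) :
    Hom (homogeneousSpace n H) (grassmannian n p) :=
  Hom.fromQuotient _ (orbitMorphism S)
    (fun x : G n ⧸ H => Quotient.liftOn' x (fun g => translate g S) fun a b hab => by
      refine Subtype.ext ?_
      have := h _ (QuotientGroup.leftRel_apply.1 hab)
      change act a S.1 = act b S.1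
      rw [← this, ← act_mul, this, mul_inv_cancel_left])
    fun _ => rfl

end Orbit

/-- The preferred generators of the Picard group of a flag variety. If `H` is the stabilizer in
`GL(n)` of the flag `F`, then `GL(n)/H` is identified, by `g H ↦ g F`, with the variety of flags
in `ℂ^n` of the same dimensions as `F`. The projection to the `j`-th Grassmannian is
`g H ↦ g (F j)`, and the `j`-th preferred generator is the pull-back of the class of `O(1)` along
this projection. -/
def preferred {n k : ℕ} {H : Subgroup (G n)} {F : Fin k → Submodule ℂ (Fin n → ℂ)}
    (h : H = stab F) (j : Fin k) : Pic (homogeneousSpace n H) :=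
  Pic.map (cosetMorphism H (⟨F j, rfl⟩ : Subsp n (finrank ℂ (F j)))
    fun _ hg => (h.le hg : _ ∈ stab F) j) (grassmannianO1 n _)

/-! ### The diagonal embedding -/

/-- The matrix `diag(x, …, x)` with `d` blocks. -/
def blockDiag (d : ℕ) {m : ℕ} (x : Matrix (Fin m) (Fin m) ℂ) :
    Matrix (Fin (d * m)) (Fin (d * m)) ℂ :=
  Matrix.of fun i j => if i.divNat = j.divNat then x i.modNat j.modNat else 0

/-- The inclusion `χ_k` of `W = ℂ^m` as the `k`-th summand `W^{(k)}` of `V = ℂ^{dm}`. -/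
def chi (d : ℕ) {m : ℕ} (k : Fin d) : (Fin m → ℂ) →ₗ[ℂ] (Fin (d * m) → ℂ) where
  toFun w i := if i.divNat = k then w i.modNat else 0
  map_add' u v := by
    funext i
    by_cases h : i.divNat = k <;> simp [h]
  map_smul' c v := by
    funext i
    by_cases h : i.divNat = k <;> simp [h]

/-- The index `(k - 1) m + r` of the `r`-th coordinate of the `k`-th block. -/
def idx {d m : ℕ} (k : Fin d) (r : Fin m) : Fin (d * m) := finProdFinEquiv (k, r)

@[simp] theorem divNat_idx {d m : ℕ} (k : Fin d) (r : Fin m) : (idx k r).divNat = k :=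
  congrArg Prod.fst (finProdFinEquiv.symm_apply_apply (k, r))

@[simp] theorem modNat_idx {d m : ℕ} (k : Fin d) (r : Fin m) : (idx k r).modNat = r :=
  congrArg Prod.snd (finProdFinEquiv.symm_apply_apply (k, r))

@[simp] theorem idx_div_mod {d m : ℕ} (i : Fin (d * m)) : idx i.divNat i.modNat = i :=
  finProdFinEquiv.apply_symm_apply i

theorem idx_inj {d m : ℕ} {k l : Fin d} {r s : Fin m} : idx k r = idx l s ↔ k = l ∧ r = s :=
  (finProdFinEquiv.injective.eq_iff).trans Prod.mk_inj

theorem sum_idx {d m : ℕ} (f : Fin (d * m) → ℂ) : ∑ i, f i = ∑ k, ∑ r, f (idx k r) := by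
  rw [← Fintype.sum_prod_type', ← finProdFinEquiv.sum_comp]
  rfl

theorem blockDiag_mulVec {d m : ℕ} (x : Matrix (Fin m) (Fin m) ℂ) (v : Fin (d * m) → ℂ)
    (k : Fin d) (r : Fin m) :
    (blockDiag d x).mulVec v (idx k r) = x.mulVec (fun s => v (idx k s)) r := by
  simp [Matrix.mulVec, dotProduct, blockDiag, sum_idx]

theorem blockDiag_chi {d m : ℕ} (x : Matrix (Fin m) (Fin m) ℂ) (k : Fin d) (w : Fin m → ℂ) :
    (blockDiag d x).mulVec (chi d k w) = chi d k (x.mulVec w) := by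
  funext i
  rw [← idx_div_mod i, blockDiag_mulVec]
  by_cases h : i.divNat = k
  · simp [chi, h]
  · simp only [chi, LinearMap.coe_mk, AddHom.coe_mk, divNat_idx, h, if_false]
    exact congrFun (Matrix.mulVec_zero x) _

/-- `x ↦ diag(x, …, x)` as a homomorphism of monoids of matrices. -/
def blockDiagHom (d m : ℕ) :
    Matrix (Fin m) (Fin m) ℂ →* Matrix (Fin (d * m)) (Fin (d * m)) ℂ where
  toFun := blockDiag d
  map_one' := by
    ext i j
    rw [← idx_div_mod i, ← idx_div_mod j]
    simp only [blockDiag, Matrix.of_apply, divNat_idx, modNat_idx, Matrix.one_apply, idx_inj]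
    by_cases h : i.divNat = j.divNat <;> simp [h]
  map_mul' x y := by
    ext i j
    by_cases h : i.divNat = j.divNat <;>
      simp [blockDiag, Matrix.mul_apply, sum_idx, h]

theorem isLinearMap_blockDiag (d m : ℕ) : IsLinearMap ℂ (blockDiag d (m := m)) where
  map_add x y := by
    ext i j
    by_cases h : i.divNat = j.divNat <;> simp [blockDiag, h]
  map_smul c x := by
    ext i j
    by_cases h : i.divNat = j.divNat <;> simp [blockDiag, h]

/-- The strict diagonal embedding `GL(m) → GL(dm)`, `x ↦ diag(x, …, x)`. -/
def diagEmb (d m : ℕ) : G m →* G (d * m) := Units.map (blockDiagHom d m)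

/-- The diagonal embedding as a morphism of varieties. -/
def diagMorphism (d m : ℕ) : Hom (glVariety m) (glVariety (d * m)) :=
  Hom.toSubspace _
    ((Hom.ofPoly (blockDiag d) fun l => linear_mem_polyFun
      (l.comp (IsLinearMap.mk' (blockDiag d) (isLinearMap_blockDiag d m)))).comp (Hom.incl _ _))
    (fun g : G m => diagEmb d m g) fun _ => rfl

/-- The intersection `P ∩ GL(m)`, where `GL(m)` is diagonally embedded in `GL(dm)`. -/
def restrict {d m : ℕ} (P : Subgroup (G (d * m))) : Subgroup (G m) := P.comap (diagEmb d m)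

/-- The morphism `φ : GL(m)/Q → GL(dm)/P` with `Q = P ∩ GL(m)` that is induced by the diagonal
embedding of groups. -/
def phi {d m : ℕ} (P : Subgroup (G (d * m))) :
    Hom (homogeneousSpace m (restrict P)) (homogeneousSpace (d * m) P) :=
  Hom.fromQuotient _ ((Hom.proj _ _).comp (diagMorphism d m))
    (fun x : G m ⧸ restrict P => Quotient.liftOn' x
      (fun g => (QuotientGroup.mk (diagEmb d m g) : G (d * m) ⧸ P)) fun a b hab => by
        have := QuotientGroup.leftRel_apply.1 hab
        refine QuotientGroup.eq.2 ?_
        rw [← map_inv, ← map_mul]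
        exact this)
    fun _ => rfl

/-! ### The flags -/

section Flags

variable {d m p q : ℕ}

/-- The basis vectors `e_i` of `V = ℂ^{dm}` that extend the basis `e_1, …, e_m` of `W = ℂ^m`:
`e_{(k-1)m+r} = χ_k(e_r)`. -/
def basisV (e : Basis (Fin m) ℂ (Fin m → ℂ)) (i : Fin (d * m)) : Fin (d * m) → ℂ :=
  chi d i.divNat (e i.modNat)

/-- The flag `F_α = {⟨e_i : α(i) ≤ j⟩}` of `V`, where `j` runs through all values of `α` but the
last. (Here `α` has `p + 1` values.) -/
def flagAlpha (e : Basis (Fin m) ℂ (Fin m → ℂ)) (α : Fin (d * m) → Fin (p + 1)) (j : Fin p) :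
    Submodule ℂ (Fin (d * m) → ℂ) :=
  Submodule.span ℂ {v | ∃ i, α i ≤ j.castSucc ∧ v = basisV e i}

/-- The map `β(r) = (α(r), α(m + r), …, α((d-1)m + r))`. -/
def beta (α : Fin (d * m) → Fin (p + 1)) (r : Fin m) (k : Fin d) : Fin (p + 1) := α (idx k r)

/-- The flag `F_β = {⟨e_r : β(r) ≤ b_j⟩}` of `W`, where `b_j` runs through all elements but the
last of the chain `b_1 < b_2 < ⋯`, which is the image of `β`. (Here it has `q + 1` elements.) -/
def flagBeta (e : Basis (Fin m) ℂ (Fin m → ℂ)) (α : Fin (d * m) → Fin (p + 1))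
    (b : Fin (q + 1) → Fin d → Fin (p + 1)) (j : Fin q) : Submodule ℂ (Fin m → ℂ) :=
  Submodule.span ℂ {v | ∃ r, beta α r ≤ b j.castSucc ∧ v = e r}

/-- The parabolic subgroup `P` of `GL(dm)`. -/
def parabolic (e : Basis (Fin m) ℂ (Fin m → ℂ)) (α : Fin (d * m) → Fin (p + 1)) :
    Subgroup (G (d * m)) := stab (flagAlpha e α)

theorem mem_flagBeta_iff {e : Basis (Fin m) ℂ (Fin m → ℂ)} {α : Fin (d * m) → Fin (p + 1)}
    {b : Fin (q + 1) → Fin d → Fin (p + 1)} {j : Fin q} {v : Fin m → ℂ} :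
    v ∈ flagBeta e α b j ↔ ∀ r, e.repr v r ≠ 0 → beta α r ≤ b j.castSucc := by
  have : {v | ∃ r, beta α r ≤ b j.castSucc ∧ v = e r} =
      e '' {r | beta α r ≤ b j.castSucc} := by
    ext v; simp [eq_comm]
  rw [flagBeta, this, e.mem_span_image]
  simp [Set.subset_def]

theorem mem_flagAlpha_iff {e : Basis (Fin m) ℂ (Fin m → ℂ)} {α : Fin (d * m) → Fin (p + 1)}
    {j : Fin p} {v : Fin (d * m) → ℂ} :
    v ∈ flagAlpha e α j ↔
      ∀ k r, e.repr (fun s => v (idx k s)) r ≠ 0 → α (idx k r) ≤ j.castSucc := by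
  constructor
  · intro hv
    induction hv using Submodule.span_induction with
    | mem v hv =>
      obtain ⟨i, hi, rfl⟩ := hv
      intro k r hr
      by_cases hk : k = i.divNat
      · subst hk
        have : (fun s => basisV e i (idx i.divNat s)) = e i.modNat := by
          funext s; simp [basisV, chi]
        rw [this, e.repr_self] at hr
        have hr' : i.modNat = r := by
          by_contra hne
          exact hr (Finsupp.single_eq_of_ne (Ne.symm hne))
        rw [← hr', idx_div_mod]
        exact hi
      · refine absurd ?_ hr
        have : (fun s => basisV e i (idx k s)) = 0 := by
          funext s; simp [basisV, chi, hk]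
        rw [this]; simp
    | zero => exact fun k r hr => absurd (by simp [← Pi.zero_def]) hr
    | add u v _ _ hu hv =>
      intro k r hr
      have : (fun s => (u + v) (idx k s)) =
        (fun s => u (idx k s)) + fun s => v (idx k s) := rfl
      rw [this, map_add, Finsupp.add_apply] at hr
      by_cases h : e.repr (fun s => u (idx k s)) r = 0
      · rw [h, zero_add] at hr
        exact hv k r hr
      · exact hu k r h
    | smul c v _ hv =>
      intro k r hr
      have : (fun s => (c • v) (idx k s)) = c • fun s => v (idx k s) := rfl
      rw [this, map_smul, Finsupp.smul_apply] at hr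
      exact hv k r (right_ne_zero_of_mul hr)
  · intro h
    have hv : v = ∑ k, ∑ r, e.repr (fun s => v (idx k s)) r • chi d k (e r) := by
      have h1 : ∀ k, ∑ r, e.repr (fun s => v (idx k s)) r • chi d k (e r) =
          chi d k fun s => v (idx k s) := fun k => by
        simp_rw [← map_smul, ← map_sum, e.sum_repr]
      simp_rw [h1]
      funext i
      rw [Finset.sum_apply, Finset.sum_eq_single i.divNat]
      · simp [chi]
      · intro k _ hk
        simp [chi, Ne.symm hk]
      · simp
    rw [hv]
    refine sum_mem fun k _ => sum_mem fun r _ => ?_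
    by_cases hr : e.repr (fun s => v (idx k s)) r = 0
    · rw [hr, zero_smul]; exact zero_mem _
    · exact Submodule.smul_mem _ _
        (Submodule.subset_span ⟨idx k r, h k r hr, by simp [basisV]⟩)

/-- The intersection `Q = P ∩ GL(m)` is the stabilizer of the flag `F_β`, so that `GL(m)/Q` is
the corresponding variety of flags in `W`. -/
theorem restrict_parabolic (e : Basis (Fin m) ℂ (Fin m → ℂ)) (α : Fin (d * m) → Fin (p + 1))
    {b : Fin (q + 1) → Fin d → Fin (p + 1)} (hb : StrictMono b)
    (hb' : Set.range b = Set.range (beta α)) :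
    restrict (parabolic e α) = stab (flagBeta e α b) := by
  ext g
  change diagEmb d m g ∈ stab (flagAlpha e α) ↔ _
  rw [mem_stab_iff, mem_stab_iff]
  change (∀ j, ∀ v ∈ flagAlpha e α j, (blockDiag d g.1).mulVec v ∈ flagAlpha e α j) ↔ _
  constructor
  · intro h j v hv
    rw [mem_flagBeta_iff] at hv ⊢
    intro r hr k
    by_cases hk : b j.castSucc k = Fin.last p
    · rw [hk]; exact Fin.le_last _
    · obtain ⟨l, hl⟩ := Fin.exists_castSucc_eq.2 hk
      have h1 : chi d k v ∈ flagAlpha e α l := by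
        rw [mem_flagAlpha_iff]
        intro k' r' hr'
        by_cases hkk : k' = k
        · subst hkk
          rw [hl]
          refine hv r' ?_ k'
          simpa [chi] using hr'
        · refine absurd ?_ hr'
          have : (fun s => chi d k v (idx k' s)) = 0 := by
            funext s; simp [chi, hkk]
          rw [this]; simp
      have h2 := h l _ h1
      rw [blockDiag_chi, mem_flagAlpha_iff] at h2
      have h3 := h2 k r (by simpa [chi] using hr)
      rw [hl] at h3
      exact h3
  · intro h j v hv
    rw [mem_flagAlpha_iff] at hv ⊢
    intro k r hr
    have hrow : (fun s => (blockDiag d g.1).mulVec v (idx k s)) =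
        g.1.mulVec fun s => v (idx k s) := funext fun s => blockDiag_mulVec _ _ _ _
    rw [hrow] at hr
    -- the largest index `i` such that the `k`-th entry of `b i` is at most `j`
    by_cases hex : ∃ i, b i k ≤ j.castSucc
    · obtain ⟨i, hi, hmax⟩ : ∃ i, b i k ≤ j.castSucc ∧ ∀ i', b i' k ≤ j.castSucc → i' ≤ i := by
        obtain ⟨i, hi⟩ := (Set.toFinite {i | b i k ≤ j.castSucc}).exists_maximal hex
        exact ⟨i, hi.1, fun i' hi' => (le_total i' i).elim id fun hle => hi.2 hi' hle⟩
      by_cases hlast : i = Fin.last q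
      · obtain ⟨i', hi'⟩ : beta α r ∈ Set.range b := hb' ▸ ⟨r, rfl⟩
        calc beta α r k = b i' k := by rw [hi']
          _ ≤ b i k := hb.monotone (hlast ▸ Fin.le_last i') k
          _ ≤ _ := hi
      · obtain ⟨l, rfl⟩ := Fin.exists_castSucc_eq.2 hlast
        have h1 : (fun s => v (idx k s)) ∈ flagBeta e α b l := by
          rw [mem_flagBeta_iff]
          intro s hs
          obtain ⟨i', hi'⟩ : beta α s ∈ Set.range b := hb' ▸ ⟨s, rfl⟩
          rw [← hi']
          refine hb.monotone (hmax i' ?_)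
          rw [hi']
          exact hv k s hs
        have h2 := h l _ h1
        rw [mem_flagBeta_iff] at h2
        exact (h2 r hr k).trans hi
    · have h0 : (fun s => v (idx k s)) = 0 := by
        apply e.repr.injective
        ext s
        by_contra hs
        obtain ⟨i', hi'⟩ : beta α s ∈ Set.range b := hb' ▸ ⟨s, rfl⟩
        refine hex ⟨i', ?_⟩
        rw [hi']
        exact hv k s (by simpa using hs)
      rw [h0, Matrix.mulVec_zero] at hr
      simp at hr

end Flags

end DiagFlag

end

namespace DiagFlag

noncomputable section

/-! ### Pull-backs of line bundles -/

/-! The proof tests line bundles on a curve in `Y`. Pick `r`, `s` with `β(r) = b_j` and `β(s) =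
b_{j+1}`, and let `GL(2)` act on the plane `⟨e_r, e_s⟩`, fixing the other basis vectors. The orbit
of the base point of `Y` is a projective line `ψ : GL(2)/B → Y`. For `i ≠ j` the subspace `F_{β,i}`
either contains both `e_r` and `e_s` or involves neither, so `GL(2)` preserves it and `ψ^*[M_i] =
0`. If the image of `φ^*` lay in the span of these `[M_i]`, then `ψ^* φ^*` would vanish.

It does not. Choose a block `k` in which `b_j` and `b_{j+1}` differ, and let `l` be the `k`-th entry
of `b_j`. On the curve, the `l`-th preferred generator of `Pic X` has degree equal, up to sign, to
the number of blocks whose copy of `e_r`, but not of `e_s`, lies in `F_{α,l}`. This number is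
positive because block `k` is counted; the order relation `b_j < b_{j+1}` excludes contributions of
the opposite sign.

Degrees are not used explicitly. A trivialization of the pulled-back `O(1)` gives a nowhere
vanishing regular function on `GL(2)` with the equivariance of the Plücker vector
(`exists_nonvanishing_of_map_hyperplane_eq_zero`). Such a function takes the same value at `diag(2,
1/2)` and at `1` (`apply_diagTwo`), so `diag(2, 1/2)` must have determinant one on `F_{α,l}`
(`det_eq_one_of_map_grassmannianO1_eq_zero`). The determinant is in fact a power of two with
positive exponent (`det_restrict_flagAlpha`, `prod_weight_ne_one`). -/

theorem Pic.map_comp {X Y Z : FunctionSpace} (ψ : Hom Y Z) (φ : Hom X Y) (L : Pic Z) :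
    Pic.map (ψ.comp φ) L = Pic.map φ (Pic.map ψ L) :=
  Quotient.inductionOn L fun _ => rfl

/-- All transition functions of the pulled-back cocycle equal the single number `g y y y`. By the
cocycle condition it is idempotent, and it is nonzero, hence it is 1. -/
theorem Pic.map_eq_zero_of_const {X Y : FunctionSpace} (φ : Hom X Y) (y : Y.Pt)
    (h : ∀ x, φ.toFun x = y) (L : Pic Y) : Pic.map φ L = 0 := by
  refine Quotient.inductionOn L fun a => Pic.mk_eq <| LineCocycle.Rel.of_eq
    (fun x => φ.preim (a.U (φ.toFun x))) (fun x => a.mem _) (fun _ => le_rfl) (fun _ => le_top)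
    fun x x' w _ _ => ?_
  change a.g (φ.toFun x) (φ.toFun x') (φ.toFun w) = 1
  rw [h, h, h]
  exact mul_left_cancel₀ ((a.unit y y).1 y ⟨a.mem y, a.mem y⟩)
    ((a.cocycle y y y y (a.mem y) (a.mem y) (a.mem y)).trans (mul_one _).symm)

/-- If the pull-back of `O(1)` along a map `Θ` to a projective space is trivial, then a lift `w` of
`Θ` to the punctured space gives a nowhere vanishing regular function with the same
equivariance as `w`. -/
theorem exists_nonvanishing_of_map_hyperplane_eq_zero {E : Type} [AddCommGroup E] [Module ℂ E]
    {X Z : FunctionSpace} (π : Hom X Z) (Θ : Hom Z (projectiveSpace E))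
    (w : Hom X (puncturedSpace E))
    (hw : ∀ x, Θ.toFun (π.toFun x) = Projectivization.mk' ℂ (w.toFun x))
    (h0 : Pic.map Θ (Pic.mk (hyperplaneBundle E)) = 0) :
    ∃ s : X.Pt → ℂ, X.IsRegular ⊤ s ∧ (∀ x, s x ≠ 0) ∧
      ∀ (x x' : X.Pt) (c : ℂ), π.toFun x = π.toFun x' →
        (w.toFun x : {v : E // v ≠ 0}).1 = c • (w.toFun x' : {v : E // v ≠ 0}).1 →
        s x = c * s x' := by
  -- The functions `h z` trivialize the bundle. Each quotient `l z (W x) / h z (π x)` is the same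
  -- trivializing section read through the lift `W`, so these quotients agree on overlaps (`key`)
  -- and glue.
  obtain ⟨V, h, hV, ha, -, hu, e⟩ : LineCocycle.Rel
      (LineCocycle.pullback Θ (hyperplaneBundle E)) (LineCocycle.one Z) := Quotient.exact h0
  let W : X.Pt → E := fun x => (w.toFun x : {v : E // v ≠ 0}).1
  let l : Z.Pt → Dual ℂ E := fun z => functional (Θ.toFun z)
  have hne : ∀ z x, π.toFun x ∈ V z → l z (W x) ≠ 0 := fun z x hx => by
    have h1 : functional (Θ.toFun z) (Projectivization.rep (Θ.toFun (π.toFun x))) ≠ 0 := ha z hx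
    rw [hw] at h1
    exact (apply_rep_ne_zero_iff _ _).1 h1
  have key : ∀ z z' x, π.toFun x ∈ V z → π.toFun x ∈ V z' →
      l z (W x) * (h z (π.toFun x))⁻¹ = l z' (W x) * (h z' (π.toFun x))⁻¹ := by
    intro z z' x hz hz'
    have h5 : l z' (Projectivization.rep (Θ.toFun (π.toFun x))) /
        l z (Projectivization.rep (Θ.toFun (π.toFun x))) = l z' (W x) / l z (W x) := by
      rw [hw]; exact apply_div_apply_rep _ _ _
    have h1 : 1 * h z' (π.toFun x) = h z (π.toFun x) * (l z' (W x) / l z (W x)) :=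
      (e z z' _ hz hz').trans (congrArg (h z (π.toFun x) * ·) h5)
    have h2 := hne z x hz
    have h3 := (hu z).1 _ hz
    have h4 := (hu z').1 _ hz'
    field_simp at h1 ⊢
    linear_combination h1
  -- At `x` the chart of the point `π x` itself is used. For regularity near `x`, `key` replaces
  -- this varying chart by a fixed one. For equivariance, `π x = π x'` makes the charts equal and
  -- only the linearity of `l` remains.
  refine ⟨fun x => l (π.toFun x) (W x) * (h (π.toFun x) (π.toFun x))⁻¹, ?_, fun x =>
    mul_ne_zero (hne _ _ (hV _)) (inv_ne_zero ((hu _).1 _ (hV _))), fun x x' c hx hc => ?_⟩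
  · refine X.glue _ _ fun x _ => ⟨π.preim (V (π.toFun x)), hV _,
      fun y => l (π.toFun x) (W y) * (h (π.toFun x) (π.toFun y))⁻¹, X.mul _ _ _ ?_ ?_,
      fun y _ hy => key _ _ _ (hV _) hy⟩
    · have : (puncturedSpace E).IsRegular ⊤
          (fun v : {v : E // v ≠ 0} => l (π.toFun x) v.1) := fun v _ =>
        ⟨⊤, trivial, fun v => l (π.toFun x) v, fun v _ =>
          ⟨fun v => l (π.toFun x) v, linear_mem_polyFun _, 1, one_mem _, one_ne_zero,
            fun y _ _ => (div_one _).symm⟩,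
          fun _ _ _ => rfl⟩
      exact (w.pull _ _ this).mono le_top fun _ _ => rfl
    · exact π.pull _ _ (hu _).2.2
  · have h1 : W x = c • W x' := hc
    change l (π.toFun x) (W x) * _ = c * (l (π.toFun x') (W x') * _)
    rw [h1, hx, map_smul, smul_eq_mul, mul_assoc]

/-! ### Units on the affine line -/

theorem exists_polynomial_of_mem_polyFun {f : ℂ → ℂ} (hf : f ∈ polyFun ℂ) :
    ∃ P : Polynomial ℂ, ∀ x, f x = P.eval x := by
  induction hf using Algebra.adjoin_induction with
  | mem f hf =>
    obtain ⟨l, rfl⟩ := hf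
    refine ⟨Polynomial.C (l 1) * Polynomial.X, fun x => ?_⟩
    have : l x = x • l 1 := by rw [← map_smul, smul_eq_mul, mul_one]
    change l x = _
    rw [this, Polynomial.eval_mul, Polynomial.eval_C, Polynomial.eval_X, smul_eq_mul, mul_comm]
  | algebraMap r => exact ⟨Polynomial.C r, fun x => by simp⟩
  | add f g _ _ hf hg =>
    obtain ⟨P, hP⟩ := hf
    obtain ⟨R, hR⟩ := hg
    exact ⟨P + R, fun x => by simp [hP, hR]⟩
  | mul f g _ _ hf hg =>
    obtain ⟨P, hP⟩ := hf
    obtain ⟨R, hR⟩ := hg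
    exact ⟨P * R, fun x => by simp [hP, hR]⟩

/-- A nowhere vanishing regular function on the affine line is constant. -/
theorem eq_of_regular_of_ne_zero {f : ℂ → ℂ} (hf : (affineSpace ℂ).IsRegular ⊤ f)
    (h0 : ∀ x, f x ≠ 0) (x y : ℂ) : f x = f y := by
  have hloc : ∀ x, ∃ A B : Polynomial ℂ, B.eval x ≠ 0 ∧
      ∀ y, B.eval y ≠ 0 → f y = A.eval y / B.eval y := fun x => by
    obtain ⟨a, ha, b, hb, h1, h2⟩ := hf x trivial
    obtain ⟨A, hA⟩ := exists_polynomial_of_mem_polyFun ha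
    obtain ⟨B, hB⟩ := exists_polynomial_of_mem_polyFun hb
    exact ⟨A, B, hB x ▸ h1, fun y hy => by
      rw [h2 y trivial (by rwa [hB]), hA, hB]⟩
  obtain ⟨A, B, hB, hAB⟩ := hloc 0
  have hB0 : B ≠ 0 := by rintro rfl; simp at hB
  -- The fraction that represents `f` near 0 is put in lowest terms. The reduced fraction `A' / B'`
  -- will turn out to represent `f` everywhere.
  obtain ⟨A', B', c, hrel, rfl, rfl⟩ :=
    UniqueFactorizationMonoid.exists_reduced_factors' A B hB0
  have hcop := hrel.isCoprime
  have hc := left_ne_zero_of_mul hB0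
  have key : ∀ x, A'.eval x ≠ 0 ∧ B'.eval x ≠ 0 ∧ f x = A'.eval x / B'.eval x := fun x => by
    obtain ⟨A₁, B₁, h1, h2⟩ := hloc x
    have hB1 : B₁ ≠ 0 := by rintro rfl; simp at h1
    have h3 : A' * B₁ = A₁ * B' := by
      -- Two local fractions agree wherever both denominators are nonzero. The factors `c * B'` and
      -- `B₁` make the product vanish at the other points as well; the second `c` restores the
      -- common factor removed from `A` and `B`.
      have : (A' * B₁ - A₁ * B') * (c * B' * (c * B₁)) = 0 := Polynomial.funext fun y => by
        by_cases hy : (c * B').eval y = 0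
        · rw [Polynomial.eval_mul, Polynomial.eval_mul, hy]; simp
        by_cases hy' : B₁.eval y = 0
        · simp [hy']
        have h4 := (hAB y hy).symm.trans (h2 y hy')
        rw [div_eq_div_iff hy hy'] at h4
        simp only [Polynomial.eval_mul, Polynomial.eval_sub, Polynomial.eval_zero] at h4 ⊢
        linear_combination c.eval y * B'.eval y * B₁.eval y * h4
      exact sub_eq_zero.1 ((mul_eq_zero.1 this).resolve_right
        (mul_ne_zero hB0 (mul_ne_zero hc hB1)))
    -- Coprimality turns `A' B₁ = A₁ B'` into `B' ∣ B₁` and `A' ∣ A₁`, so neither `A'` nor `B'`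
    -- vanishes at `x`.
    have h4 : A₁.eval x ≠ 0 := fun h => h0 x (by rw [h2 x h1, h, zero_div])
    have h5 : B'.eval x ≠ 0 := fun h => h1 <| Polynomial.IsRoot.dvd h <|
      hcop.symm.dvd_of_dvd_mul_left ⟨A₁, h3.trans (mul_comm _ _)⟩
    have h6 : A'.eval x ≠ 0 := fun h => h4 <| Polynomial.IsRoot.dvd h <|
      hcop.dvd_of_dvd_mul_right ⟨B₁, h3.symm⟩
    refine ⟨h6, h5, ?_⟩
    rw [h2 x h1, div_eq_div_iff h1 h5]
    simpa using (congrArg (Polynomial.eval x) h3).symm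
  -- Since ℂ is algebraically closed, a polynomial without roots is constant; this applies to `A'`
  -- and to `B'`.
  have hconst : ∀ P : Polynomial ℂ, (∀ x, P.eval x ≠ 0) → P.eval x = P.eval y := fun P hP => by
    by_cases hdeg : P.degree = 0
    · rw [Polynomial.eq_C_of_degree_eq_zero hdeg]; simp
    · obtain ⟨z, hz⟩ := IsAlgClosed.exists_root P hdeg
      exact absurd hz (hP z)
  rw [(key x).2.2, (key y).2.2, hconst A' fun z => (key z).1, hconst B' fun z => (key z).2.1]

/-! ### Units on `GL(n)` -/

section Unipotent

variable {n : ℕ}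

/-- The element `1 + t N` of `GL(n)`, where `N² = 0`. -/
def unipotent (N : Matrix (Fin n) (Fin n) ℂ) (hN : N * N = 0) (t : ℂ) : G n where
  val := 1 + t • N
  inv := 1 - t • N
  val_inv := by simp [mul_sub, add_mul, hN]
  inv_val := by simp [mul_add, sub_mul, hN]

/-- The affine line `t ↦ g (1 + t N)` in `GL(n)`. -/
def unipotentCurve (g : G n) (N : Matrix (Fin n) (Fin n) ℂ) (hN : N * N = 0) :
    Hom (affineSpace ℂ) (glVariety n) :=
  Hom.toSubspace _
    (Hom.ofPoly (fun t : ℂ => g.1 * (1 + t • N)) fun l => by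
      have : (fun t : ℂ => l (g.1 * (1 + t • N))) =
          (fun _ => l g.1) + fun t => (LinearMap.toSpanSingleton ℂ ℂ (l (g.1 * N))) t := by
        funext t
        simp [mul_add]
      rw [this]
      exact add_mem ((polyFun ℂ).algebraMap_mem _) (linear_mem_polyFun _))
    (fun t => g * unipotent N hN t) fun _ => rfl

/-- Along the affine line `t ↦ g (1 + t N)` the function `s` is a unit, hence constant; compare its
values at `t` and at 0. -/
theorem apply_mul_unipotent {s : G n → ℂ} (hs : (glVariety n).IsRegular ⊤ s)
    (h0 : ∀ g, s g ≠ 0) (g : G n) (N : Matrix (Fin n) (Fin n) ℂ) (hN : N * N = 0) (t : ℂ) :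
    s (g * unipotent N hN t) = s g := by
  have := eq_of_regular_of_ne_zero ((unipotentCurve g N hN).pull _ _ hs) (fun _ => h0 _) t 0
  refine this.trans (congrArg s ?_)
  change g * unipotent N hN 0 = g
  ext1
  simp [unipotent]

end Unipotent

/-- The matrix `diag(2, 1/2)`. -/
def diagTwo : G 2 where
  val := !![2, 0; 0, 1/2]
  inv := !![1/2, 0; 0, 2]
  val_inv := by ext i j; fin_cases i <;> fin_cases j <;> simp [Matrix.mul_apply]
  inv_val := by ext i j; fin_cases i <;> fin_cases j <;> simp [Matrix.mul_apply]

/-- Right multiplication by elementary unipotent matrices does not change a unit, and `diag(2,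
1/2)`, having determinant one, is a product of such matrices. -/
theorem apply_diagTwo {s : G 2 → ℂ} (hs : (glVariety 2).IsRegular ⊤ s)
    (h0 : ∀ g, s g ≠ 0) : s diagTwo = s 1 := by
  have hU : (!![0, 1; 0, 0] : Matrix (Fin 2) (Fin 2) ℂ) * !![0, 1; 0, 0] = 0 := by
    ext i j; fin_cases i <;> fin_cases j <;> simp [Matrix.mul_apply]
  have hL : (!![0, 0; 1, 0] : Matrix (Fin 2) (Fin 2) ℂ) * !![0, 0; 1, 0] = 0 := by
    ext i j; fin_cases i <;> fin_cases j <;> simp [Matrix.mul_apply]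
  -- The first two factors multiply to the matrix with rows (2, 1) and (1, 1); the last two clear
  -- its off-diagonal entries by column operations. The leading 1 lets every factor be removed by
  -- `apply_mul_unipotent`.
  have : diagTwo = 1 * unipotent _ hU 1 * unipotent _ hL 1 * unipotent _ hU (-1/2) *
      unipotent _ hL (-2) := by
    ext i j
    fin_cases i <;> fin_cases j <;>
      simp [diagTwo, unipotent, Matrix.mul_apply, Fin.sum_univ_two] <;> norm_num
  rw [this]
  simp only [apply_mul_unipotent hs h0]

end

end DiagFlag

namespace DiagFlag

noncomputable section

/-! ### The embedding of `GL(2)` that acts on the plane spanned by two basis vectors -/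

section Plane

variable {m : ℕ} (e : Basis (Fin m) ℂ (Fin m → ℂ)) {v : Fin 2 → Fin m} (hv : Function.Injective v)

/-- The inclusion of the plane spanned by `e (v 0)` and `e (v 1)`. -/
def planeIncl (v : Fin 2 → Fin m) : Matrix (Fin m) (Fin 2) ℂ := Matrix.of fun x a => e (v a) x

/-- The projection to the plane spanned by `e (v 0)` and `e (v 1)`. -/
def planeProj (v : Fin 2 → Fin m) : Matrix (Fin 2) (Fin m) ℂ :=
  LinearMap.toMatrix' (LinearMap.pi fun a => e.coord (v a))

theorem planeProj_mulVec (w : Fin m → ℂ) (a : Fin 2) :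
    (planeProj e v).mulVec w a = e.repr w (v a) := by
  rw [planeProj, LinearMap.toMatrix'_mulVec]
  rfl

theorem planeIncl_mulVec (c : Fin 2 → ℂ) :
    (planeIncl e v).mulVec c = ∑ a, c a • e (v a) := by
  funext x
  simp [planeIncl, Matrix.mulVec, dotProduct, mul_comm]

-- This identity makes `planeMatrix` multiplicative; it needs the two chosen basis vectors to be
-- distinct.
include hv in
theorem planeProj_mul_planeIncl : planeProj e v * planeIncl e v = 1 := by
  ext a b
  have : (planeProj e v * planeIncl e v) a b = (planeProj e v).mulVec (e (v b)) a := rfl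
  rw [this, planeProj_mulVec, e.repr_self, Finsupp.single_apply, Matrix.one_apply]
  simp [hv.eq_iff, eq_comm]

/-- The matrix that acts as `x` on the plane spanned by `e (v 0)` and `e (v 1)` and fixes the other
basis vectors. -/
def planeMatrix (v : Fin 2 → Fin m) (x : Matrix (Fin 2) (Fin 2) ℂ) : Matrix (Fin m) (Fin m) ℂ :=
  1 + planeIncl e v * (x - 1) * planeProj e v

theorem planeMatrix_mulVec (x : Matrix (Fin 2) (Fin 2) ℂ) (w : Fin m → ℂ) :
    (planeMatrix e v x).mulVec w =
      w + ∑ a, (x - 1).mulVec (fun a => e.repr w (v a)) a • e (v a) := by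
  rw [planeMatrix, Matrix.add_mulVec, Matrix.one_mulVec, ← Matrix.mulVec_mulVec,
    ← Matrix.mulVec_mulVec, planeIncl_mulVec]
  simp only [← planeProj_mulVec]

/-- `planeMatrix` as a homomorphism of monoids. -/
def planeMatrixHom : Matrix (Fin 2) (Fin 2) ℂ →* Matrix (Fin m) (Fin m) ℂ where
  toFun := planeMatrix e v
  map_one' := by simp [planeMatrix]
  map_mul' x y := by
    have h : planeIncl e v * (x - 1) * planeProj e v * (planeIncl e v * (y - 1) * planeProj e v) =
        planeIncl e v * ((x - 1) * (y - 1)) * planeProj e v := by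
      rw [Matrix.mul_assoc (planeIncl e v * (x - 1)), Matrix.mul_assoc (planeIncl e v) (y - 1),
        ← Matrix.mul_assoc (planeProj e v), planeProj_mul_planeIncl e hv, Matrix.one_mul]
      simp only [Matrix.mul_assoc]
    have h' : x * y - 1 = (x - 1) + (y - 1) + (x - 1) * (y - 1) := by noncomm_ring
    simp only [planeMatrix]
    rw [h', mul_add, mul_one, add_mul, one_mul, h]
    simp only [Matrix.mul_add, Matrix.add_mul]
    abel

/-- The embedding of `GL(2)` in `GL(m)` that acts on the plane spanned by `e (v 0)` and
`e (v 1)`. -/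
def planeEmb : G 2 →* G m := Units.map (planeMatrixHom e hv)

/-- The embedding of `GL(2)` in `GL(m)` as a morphism of varieties. -/
def planeMorphism : Hom (glVariety 2) (glVariety m) :=
  Hom.toSubspace _
    ((Hom.ofPoly (planeMatrix e v) fun l => by
      let A : Matrix (Fin 2) (Fin 2) ℂ →ₗ[ℂ] Matrix (Fin m) (Fin m) ℂ :=
        { toFun := fun x => planeIncl e v * x * planeProj e v
          map_add' := fun x y => by rw [Matrix.mul_add, Matrix.add_mul]
          map_smul' := fun c x => by simp }
      have : (fun x => l (planeMatrix e v x)) =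
          (fun _ => l (1 - planeIncl e v * planeProj e v)) + fun x => (l.comp A) x := by
        funext x
        change _ = l _ + l (planeIncl e v * x * planeProj e v)
        rw [← map_add, planeMatrix, Matrix.mul_sub, Matrix.sub_mul, Matrix.mul_one]
        congr 1
        abel
      rw [this]
      exact add_mem ((polyFun _).algebraMap_mem _) (linear_mem_polyFun _)).comp (Hom.incl _ _))
    (fun g : G 2 => planeEmb e hv g) fun _ => rfl

/-- The vector `w` is moved by a combination of the `e (v a)` whose coefficients depend linearly on
the coordinates of `w` at `v 0` and `v 1`. In the first case this combination lies in `S`, in the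
second it is zero. -/
theorem planeEmb_mulVec_mem {S : Submodule ℂ (Fin m → ℂ)}
    (hS : (∀ a, e (v a) ∈ S) ∨ ∀ w ∈ S, ∀ a, e.repr w (v a) = 0) (g : G 2) {w : Fin m → ℂ}
    (hw : w ∈ S) : (planeEmb e hv g).1.mulVec w ∈ S := by
  change (planeMatrix e v g.1).mulVec w ∈ S
  rw [planeMatrix_mulVec]
  rcases hS with h | h
  · exact add_mem hw (sum_mem fun a _ => S.smul_mem _ (h a))
  · have : (fun a => e.repr w (v a)) = 0 := funext (h w hw)
    rw [this, Matrix.mulVec_zero]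
    simpa using hw

/-- The eigenvalues of the image of `diag(2, 1/2)`. -/
def weight (v : Fin 2 → Fin m) (u : Fin m) : ℂ := if u = v 0 then 2 else if u = v 1 then 1/2 else 1

theorem planeEmb_diagTwo_mulVec (u : Fin m) :
    (planeEmb e hv diagTwo).1.mulVec (e u) = weight v u • e u := by
  change (planeMatrix e v diagTwo.1).mulVec (e u) = _
  have h01 : v 0 ≠ v 1 := fun h => by simpa using hv h
  rw [planeMatrix_mulVec]
  have h1 : (diagTwo.1 - 1 : Matrix (Fin 2) (Fin 2) ℂ) = !![1, 0; 0, -1/2] := by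
    ext i j
    fin_cases i <;> fin_cases j <;> simp [diagTwo] <;> norm_num
  rw [h1]
  simp only [Fin.sum_univ_two, Matrix.mulVec, dotProduct, e.repr_self, Finsupp.single_apply,
    weight]
  by_cases hu : u = v 0
  · subst hu
    simp [h01, two_smul]
  · by_cases hu' : u = v 1
    · subst hu'
      simp only [hu, if_false, if_true]
      simp
      rw [← one_smul ℂ (e (v 1)), smul_smul, ← add_smul]
      norm_num
    · simp [hu, hu']

end Plane

/-! ### Determinants and exterior powers -/

/-- The top exterior power of `S` is a line on which `T` acts by its determinant. The identity is
tested against the functionals on `⋀^N E`: each restricts to an alternating `N`-form on `S`, a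
multiple of the determinant form of the basis `f`. -/
theorem ιMulti_map_eq_det_smul {E : Type} [AddCommGroup E] [Module ℂ E] {N : ℕ}
    {S : Submodule ℂ E} (f : Basis (Fin N) ℂ S) (T : S →ₗ[ℂ] S) :
    exteriorPower.ιMulti ℂ N (fun i => (T (f i)).1) =
      LinearMap.det T • exteriorPower.ιMulti ℂ N fun i => (f i).1 := by
  rw [← sub_eq_zero, ← Module.forall_dual_apply_eq_zero_iff ℂ]
  intro l
  let F : S [⋀^Fin N]→ₗ[ℂ] ℂ :=
    (l.compAlternatingMap (exteriorPower.ιMulti ℂ N)).compLinearMap S.subtype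
  have h : F (T ∘ f) = LinearMap.det T * F f := by
    rw [F.eq_smul_basis_det f]
    simp only [AlternatingMap.smul_apply, smul_eq_mul, Basis.det_comp, Basis.det_self]
    ring
  rw [map_sub, map_smul, smul_eq_mul]
  exact sub_eq_zero.2 h

theorem det_eq_prod_of_apply_basis {E ι : Type} [AddCommGroup E] [Module ℂ E] [Fintype ι]
    (f : Basis ι ℂ E) (T : E →ₗ[ℂ] E) (c : ι → ℂ) (h : ∀ i, T (f i) = c i • f i) :
    LinearMap.det T = ∏ i, c i := by
  classical
  rw [← LinearMap.det_toMatrix f, ← Matrix.det_diagonal]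
  congr 1
  ext i j
  rw [LinearMap.toMatrix_apply, h, map_smul, f.repr_self, Matrix.diagonal_apply]
  by_cases hij : i = j <;> simp [hij]

theorem linearIndependent_basisV {d m : ℕ} (e : Basis (Fin m) ℂ (Fin m → ℂ)) :
    LinearIndependent ℂ (basisV e : Fin (d * m) → Fin (d * m) → ℂ) := by
  rw [Fintype.linearIndependent_iff]
  intro c hc i
  have h : ∑ t, c (idx i.divNat t) • e t = 0 := by
    funext s
    have := congrFun hc (idx i.divNat s)
    rw [Finset.sum_apply, sum_idx] at this
    simpa [basisV, chi] using this
  have := Fintype.linearIndependent_iff.1 e.linearIndependent _ h i.modNat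
  rwa [idx_div_mod] at this

/-! ### The action of a scaling of the basis on the subspaces of the flag -/

section Scaling

variable {d m p : ℕ} {e : Basis (Fin m) ℂ (Fin m → ℂ)} {α : Fin (d * m) → Fin (p + 1)} {g : G m}
  {c : Fin m → ℂ} (hg : ∀ u, g.1.mulVec (e u) = c u • e u)

include hg in
theorem diagEmb_mulVec_basisV (i : Fin (d * m)) :
    (diagEmb d m g).1.mulVec (basisV e i) = c i.modNat • basisV e i := by
  change (blockDiag d g.1).mulVec _ = _
  rw [basisV, blockDiag_chi, hg, map_smul]

include hg in
theorem diagEmb_mulVec_mem_flagAlpha (l : Fin p) {w : Fin (d * m) → ℂ}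
    (hw : w ∈ flagAlpha e α l) : (diagEmb d m g).1.mulVecLin w ∈ flagAlpha e α l := by
  refine (Submodule.span_le (p := (flagAlpha e α l).comap (diagEmb d m g).1.mulVecLin)).2 ?_ hw
  rintro _ ⟨i, hi, rfl⟩
  change (diagEmb d m g).1.mulVec _ ∈ flagAlpha e α l
  rw [diagEmb_mulVec_basisV hg]
  exact Submodule.smul_mem _ _ (Submodule.subset_span ⟨i, hi, rfl⟩)

/-- The vectors `basisV e i` with `α i ≤ l` form an eigenbasis of this subspace. The product of
their eigenvalues is arranged by blocks, with 1 standing for each index outside the subspace. -/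
theorem det_restrict_flagAlpha (l : Fin p) :
    LinearMap.det ((diagEmb d m g).1.mulVecLin.restrict
      fun w (hw : w ∈ flagAlpha e α l) => diagEmb_mulVec_mem_flagAlpha hg l hw) =
      ∏ k : Fin d, ∏ u, if α (idx k u) ≤ l.castSucc then c u else 1 := by
  have hS : Submodule.span ℂ (Set.range fun i : {i // α i ≤ l.castSucc} => basisV e i.1) =
      flagAlpha e α l := by
    rw [flagAlpha]
    congr 1
    ext w
    simp [eq_comm]
  let f : Basis {i // α i ≤ l.castSucc} ℂ (flagAlpha e α l) :=
    (Basis.span ((linearIndependent_basisV e).comp _ Subtype.val_injective)).map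
      (LinearEquiv.ofEq _ _ hS)
  have hf : ∀ i, (f i).1 = basisV e i.1 := fun i => by
    simp [f, Basis.span_apply]
  rw [det_eq_prod_of_apply_basis f _ fun i => c i.1.modNat]
  · rw [← Fintype.prod_prod_type' (f := fun k u => if α (idx k u) ≤ l.castSucc then c u else 1),
      ← Finset.prod_subtype (Finset.univ.filter fun i => α i ≤ l.castSucc) (by simp)
        fun i => c i.modNat, Finset.prod_filter, ← finProdFinEquiv.prod_comp]
    refine Finset.prod_congr rfl fun x _ => ?_
    change (if α (idx x.1 x.2) ≤ _ then c (idx x.1 x.2).modNat else 1) = _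
    rw [modNat_idx]
  · intro i
    ext1
    rw [LinearMap.coe_restrict_apply, Submodule.coe_smul, hf]
    exact diagEmb_mulVec_basisV hg i.1

end Scaling

/-- Only `v 0` and `v 1` have weight different from 1. A block contributes 2 if it contains the
first alone, 2 · 1/2 = 1 if both, and 1 if neither; `hle` excludes the second alone, so no factor
1/2 can compensate. The product is a power of 2 whose exponent is positive because it counts the
block `k`. -/
theorem prod_weight_ne_one {d m p : ℕ} (α : Fin (d * m) → Fin (p + 1)) (l : Fin (p + 1))
    {v : Fin 2 → Fin m} (hv : Function.Injective v)
    (hle : beta α (v 0) ≤ beta α (v 1)) (k : Fin d) (h0 : beta α (v 0) k ≤ l)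
    (h1 : ¬ beta α (v 1) k ≤ l) :
    ∏ k : Fin d, ∏ u, (if α (idx k u) ≤ l then weight v u else 1) ≠ 1 := by
  have h01 : v 0 ≠ v 1 := fun h => by simpa using hv h
  have h : ∀ k, ∏ u, (if α (idx k u) ≤ l then weight v u else 1) =
      if beta α (v 0) k ≤ l ∧ ¬ beta α (v 1) k ≤ l then 2 else 1 := by
    intro k
    rw [Fintype.prod_eq_mul _ _ h01 fun u hu => by simp [weight, hu.1, hu.2]]
    have := hle k
    simp only [weight, if_true, h01.symm, if_false]
    change (if beta α (v 0) k ≤ l then _ else _) * (if beta α (v 1) k ≤ l then _ else _) = _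
    by_cases ha : beta α (v 0) k ≤ l <;> by_cases hb : beta α (v 1) k ≤ l
    · simp [ha, hb]
    · simp [ha, hb]
    · exact absurd (this.trans hb) ha
    · simp [ha, hb]
  simp only [h]
  rw [Finset.prod_ite, Finset.prod_const, Finset.prod_const_one, mul_one]
  intro hpow
  have h2 : (2 : ℕ) ^ (Finset.univ.filter fun k =>
    beta α (v 0) k ≤ l ∧ ¬ beta α (v 1) k ≤ l).card = 1 := by exact_mod_cast hpow
  rw [Nat.pow_eq_one] at h2
  have h3 : k ∈ Finset.univ.filter fun k => beta α (v 0) k ≤ l ∧ ¬ beta α (v 1) k ≤ l := by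
    simp [h0, not_le.1 h1]
  rcases h2 with h2 | h2
  · omega
  · rw [Finset.card_eq_zero] at h2
    rw [h2] at h3
    simp at h3

/-! ### Morphisms of homogeneous spaces -/

/-- The morphism `GL(a)/f⁻¹(H) → GL(b)/H` that is induced by a homomorphism `f` of groups. -/
def homogeneousHom {a b : ℕ} (F : Hom (glVariety a) (glVariety b)) (f : G a →* G b)
    (hF : ∀ g, F.toFun g = f g) (H : Subgroup (G b)) :
    Hom (homogeneousSpace a (H.comap f)) (homogeneousSpace b H) :=
  Hom.fromQuotient _ ((Hom.proj _ _).comp F)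
    (fun x : G a ⧸ H.comap f => Quotient.liftOn' x (fun g => (QuotientGroup.mk (f g) : G b ⧸ H))
      fun g g' h => by
        have := QuotientGroup.leftRel_apply.1 h
        refine QuotientGroup.eq.2 ?_
        rw [← map_inv, ← map_mul]
        exact this)
    fun g => (congrArg (fun x : G b => (QuotientGroup.mk x : G b ⧸ H)) (hF g)).symm

/-- A line bundle of Plücker type can be trivial on the orbit of `GL(2)` only if `diag(2, 1/2)`
acts with determinant one on the subspace. -/
theorem det_eq_one_of_map_grassmannianO1_eq_zero {n N : ℕ} {H : Subgroup (G n)} {S : Subsp n N}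
    (hS : ∀ g ∈ H, act g S.1 = S.1) {B : Subgroup (G 2)} (hB : diagTwo ∈ B)
    (F : Hom (glVariety 2) (glVariety n)) (f : G 2 →* G n) (hF : ∀ g, F.toFun g = f g)
    (ψ : Hom (homogeneousSpace 2 B) (homogeneousSpace n H))
    (hψ : ∀ g : G 2, ψ.toFun (QuotientGroup.mk g : G 2 ⧸ B) = (QuotientGroup.mk (f g) : G n ⧸ H))
    (h0 : Pic.map ψ (Pic.map (cosetMorphism H S hS) (grassmannianO1 n N)) = 0)
    (T : S.1 →ₗ[ℂ] S.1) (hT : ∀ w, (T w).1 = (f diagTwo).1.mulVec w.1) :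
    LinearMap.det T = 1 := by
  let I : Hom (grassmannian n N) (projectiveSpace (⋀[ℂ]^N (Fin n → ℂ))) :=
    Hom.incl (projectiveSpace (⋀[ℂ]^N (Fin n → ℂ))) (T := Subsp n N) plucker
  let Θ := I.comp ((cosetMorphism H S hS).comp ψ)
  let π : Hom (glVariety 2) (homogeneousSpace 2 B) :=
    Hom.proj (glVariety 2) fun g : G 2 => (QuotientGroup.mk g : G 2 ⧸ B)
  have hlift : ∀ g : G 2, ((wedgeMorphism S).comp F).toFun g =
      (⟨exteriorPower.ιMulti ℂ N fun i => (f g).1.mulVec (frame S i).1,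
        wedge_ne_zero (frame_indep S (f g))⟩ : {v : ⋀[ℂ]^N (Fin n → ℂ) // v ≠ 0}) := fun g =>
    congrArg (wedgeMorphism S).toFun (hF g)
  have hΘ : ∀ g : G 2, Θ.toFun (π.toFun g) =
      Projectivization.mk' ℂ (((wedgeMorphism S).comp F).toFun g) := fun g => by
    have h1 : (cosetMorphism H S hS).toFun (ψ.toFun (QuotientGroup.mk g : G 2 ⧸ B)) =
        translate (f g) S := (congrArg (cosetMorphism H S hS).toFun (hψ g)).trans rfl
    have h2 : plucker ((cosetMorphism H S hS).toFun (ψ.toFun (QuotientGroup.mk g : G 2 ⧸ B))) =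
        plucker (translate (f g) S) := congrArg plucker h1
    exact h2.trans ((plucker_translate (f g) S).trans
      (congrArg (Projectivization.mk' ℂ) (hlift g).symm))
  have hzero : Pic.map Θ (Pic.mk (hyperplaneBundle (⋀[ℂ]^N (Fin n → ℂ)))) = 0 :=
    (Pic.map_comp I _ _).trans ((Pic.map_comp (cosetMorphism H S hS) ψ _).trans h0)
  obtain ⟨σ, hσ, hσ0, hσc⟩ :=
    exists_nonvanishing_of_map_hyperplane_eq_zero π Θ ((wedgeMorphism S).comp F) hΘ hzero
  have hw : ∀ g : G 2, (((wedgeMorphism S).comp F).toFun g :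
      {v : ⋀[ℂ]^N (Fin n → ℂ) // v ≠ 0}).1 =
      exteriorPower.ιMulti ℂ N fun i => (f g).1.mulVec (frame S i).1 := fun g =>
    congrArg Subtype.val (hlift g)
  -- Since `diagTwo ∈ B`, the matrices `diagTwo` and 1 represent the same coset, while their Plücker
  -- vectors differ by the factor `det T`. Hence `σ diagTwo = det T * σ 1`, to be compared with
  -- `apply_diagTwo`.
  have h1 := hσc diagTwo (1 : G 2) (LinearMap.det T)
    (QuotientGroup.eq.2 (by simpa using inv_mem hB)) (by
      refine (hw diagTwo).trans (.trans ?_ (congrArg (LinearMap.det T • ·) (hw 1).symm))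
      simpa [hT] using ιMulti_map_eq_det_smul (frame S) T)
  rw [apply_diagTwo hσ hσ0] at h1
  exact mul_right_cancel₀ (hσ0 (1 : G 2)) (h1.symm.trans (one_mul _).symm)

end

end DiagFlag

/-! ### The test curve through consecutive steps of the chain, and the contradiction. -/

open DiagFlag in
theorem corollary5p5 (m d : ℕ) (hm : 0 < m) (hd : 1 < d)
    (e : Module.Basis (Fin m) ℂ (Fin m → ℂ))
    (p q : ℕ) (α : Fin (d * m) → Fin (p + 1)) (hα : Function.Surjective α)
    (b : Fin (q + 1) → Fin d → Fin (p + 1)) (hb : StrictMono b)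
    (hb' : Set.range b = Set.range (beta α)) (j : Fin q) :
    ¬ ((Pic.map (phi (parabolic e α))).range ≤
      AddSubgroup.closure
        ((fun i => preferred (restrict_parabolic e α hb hb') i) '' {i | i ≠ j})) := by
  intro hle
  obtain ⟨r, hr⟩ : b j.castSucc ∈ Set.range (beta α) := hb' ▸ ⟨_, rfl⟩
  obtain ⟨s, hs⟩ : b j.succ ∈ Set.range (beta α) := hb' ▸ ⟨_, rfl⟩
  have hlt : b j.castSucc < b j.succ := hb j.castSucc_lt_succ
  obtain ⟨hle', k, hk⟩ := Pi.lt_def.1 hlt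
  -- The `k`-th entry of `b_j` lies strictly below that of `b_{j+1}`, so it is not the last value of
  -- `α` and indexes a member of the flag `F_α`.
  obtain ⟨l, hl⟩ : ∃ l : Fin p, l.castSucc = b j.castSucc k :=
    Fin.exists_castSucc_eq.2 (hk.trans_le (Fin.le_last _)).ne
  let v : Fin 2 → Fin m := ![r, s]
  have hv : Function.Injective v := by
    have hrs : r ≠ s := by
      rintro rfl
      exact hlt.ne (hr.symm.trans hs)
    intro x y hxy
    fin_cases x <;> fin_cases y <;> simp_all [v]
  let ψ := homogeneousHom (planeMorphism e hv) (planeEmb e hv) (fun _ => rfl)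
    (restrict (parabolic e α))
  -- the curve `ψ` is contracted by all but the `j`-th projection
  have hkill : ∀ i, i ≠ j → Pic.map ψ (preferred (restrict_parabolic e α hb hb') i) = 0 := by
    intro i hij
    unfold preferred
    rw [← Pic.map_comp]
    refine Pic.map_eq_zero_of_const _ (⟨flagBeta e α b i, rfl⟩ : Subsp m _) (fun x => ?_) _
    induction x using QuotientGroup.induction_on with | H g => ?_
    refine Subtype.ext ?_
    change act (planeEmb e hv g) (flagBeta e α b i) = flagBeta e α b i
    refine Submodule.eq_of_le_of_finrank_eq ?_ (finrank_act _ _)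
    rintro _ ⟨w, hw, rfl⟩
    refine planeEmb_mulVec_mem e hv ?_ g hw
    -- For `i < j`, a vector of `F_{β,i}` with a nonzero coordinate at `r` or `s` would force `b_j ≤
    -- b_i`. For `i > j`, both `β(r)` and `β(s)` are at most `b_{j+1} ≤ b_i`, so `e_r` and `e_s` lie
    -- in `F_{β,i}`.
    rcases lt_or_gt_of_ne hij with h | h
    · right
      intro w hw a
      by_contra hne
      have h1 := mem_flagBeta_iff.1 hw _ hne
      have h2 : b j.castSucc ≤ beta α (v a) := by
        fin_cases a
        · exact hr.ge
        · exact hlt.le.trans hs.ge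
      exact (hb (Fin.castSucc_lt_castSucc_iff.2 h)).not_ge (h2.trans h1)
    · left
      intro a
      refine Submodule.subset_span ⟨v a, ?_, rfl⟩
      have h2 : beta α (v a) ≤ b j.succ := by
        fin_cases a
        · exact hr.le.trans hlt.le
        · exact hs.le
      exact h2.trans (hb.monotone (by rw [Fin.le_def]; simpa using h))
  have hker : AddSubgroup.closure
      ((fun i => preferred (restrict_parabolic e α hb hb') i) '' {i | i ≠ j}) ≤
      (Pic.map ψ).ker := by
    rw [AddSubgroup.closure_le]
    rintro _ ⟨i, hi, rfl⟩
    exact hkill i hi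
  let S : Subsp (d * m) (Module.finrank ℂ (flagAlpha e α l)) := ⟨flagAlpha e α l, rfl⟩
  have hS : ∀ g ∈ parabolic e α, act g S.1 = S.1 := fun g hg =>
    (show g ∈ stab (flagAlpha e α) from hg) l
  -- The assumed inclusion enters here: `φ^*` of this class lies in the subgroup generated by the
  -- `[M_i]` with `i ≠ j`, which `ψ^*` kills.
  have h0 : Pic.map ((phi (parabolic e α)).comp ψ)
      (Pic.map (cosetMorphism (parabolic e α) S hS) (grassmannianO1 _ _)) = 0 := by
    rw [Pic.map_comp]
    exact hker (hle ⟨_, rfl⟩)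
  have hT := planeEmb_diagTwo_mulVec e hv
  -- The image of `diagTwo` scales every basis vector of `V`, so it preserves all members of `F_α`.
  have hmem : diagTwo ∈ (restrict (parabolic e α)).comap (planeEmb e hv) :=
    mem_stab_iff.2 fun l' w hw => diagEmb_mulVec_mem_flagAlpha hT l' hw
  have h1 := det_eq_one_of_map_grassmannianO1_eq_zero hS hmem
    ((diagMorphism d m).comp (planeMorphism e hv)) ((diagEmb d m).comp (planeEmb e hv))
    (fun _ => rfl) _ (fun _ => rfl) h0 ((diagEmb d m (planeEmb e hv
      diagTwo)).1.mulVecLin.restrict fun _ hw => diagEmb_mulVec_mem_flagAlpha hT l hw)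
    fun _ => rfl
  rw [det_restrict_flagAlpha hT] at h1
  refine prod_weight_ne_one α l.castSucc hv ?_ k ?_ ?_ h1
  · change beta α r ≤ beta α s
    rw [hr, hs]; exact hle'
  · change beta α r k ≤ _
    rw [hr, hl]
  · change ¬ beta α s k ≤ _
    rw [hs, hl]; exact hk.not_ge
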